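/- **Théorème 3.4 (Hartogs).** Let $A$ be a unital associative real algebra of finite dimension $k$, with a basis $e_1,\dots,e_k$ that identifies $A$ with $\mathbb{R}^k$. *Cauchy conditions* on a real vector space $E$ with coordinates $x_1,\dots,x_N$ are given by elements $a_m^j\in A$ ($1\le m\le q$, $1\le j\le N$); a function $f:U\to A$ on an open set $U\subseteq E$ is *Cauchy* on $U$ if it is of class $C^1$ and $$\sum_{j=1}^{N}\frac{\partial f}{\partial x_j}\,a_m^j=0\quad\text{on }U,\qquad m=1,\dots,q .$$ The conditions are *admissible* on $E$ if they admit a Cauchy kernel, i.e. if there are $C^1$ functions $\varphi_m:E\times E\to A$ $(1\le m\le q)$, vanishing on the diagonal, such that, for every smooth compactly supported $f:E\to A$ and every $x\in E$, $$f(x)=-\int_E \frac{1}{\|y-x\|^{N}}\sum_{m=1}^{q}\sum_{j=1}^{N}\frac{\partial f}{\partial y_j}(y)\,a_m^j\,\varphi_m(x,y)\,dy_1\cdots dy_N ,$$ where $\|\cdot\|$ is the Euclidean norm in the coordinates. Given Cauchy conditions $(a_m^j)_{1\le m\le q,\,1\le j\le k}$ on $A$, the *induced* conditions on $A^n$ are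 these conditions imposed in each of the $n$ variables separately: $\sum_{j=1}^k \frac{\partial f}{\partial x_{l,j}}\,a_m^j=0$ for all $1\le l\le n$ and $1\le m\le q$, where $x_{l,1},\dots,x_{l,k}$ are the coordinates of the $l$-th variable. Let $n\ge 2$, and take on $A^n$ the Cauchy conditions induced by admissible Cauchy conditions on $A$. Let $D\subset A^n$ be a bounded domain with smooth boundary, let $U\subset A^n$ be a connected open set containing $\partial D$ (a shell around $\partial D$), and let $f$ be an $A$-valued Cauchy function on $U$. Then $f$ extends to a Cauchy function on all of $D$: there is a Cauchy function $F$ on $D\cup U$ with $F=f$ on $U$. -/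

import Mathlib

open scoped ContDiff

/-- A function `f` with values in `A` is *Cauchy* on the open set `U` for the conditions
`∑ j, (∂f/∂x_j) a_m^j = 0` (one for each `m`): it is of class `C¹` there and satisfies them at every
point.  `x_j` are the coordinates of `E` in the basis `v`, and `a m j` stands for `a_m^j`. -/
def IsCauchyOn {E A ι κ : Type*} [NormedAddCommGroup E] [NormedSpace ℝ E] [NormedRing A]
    [NormedAlgebra ℝ A] [Fintype ι] (v : Module.Basis ι ℝ E) (a : κ → ι → A)
    (f : E → A) (U : Set E) : Prop :=
  ContDiffOn ℝ 1 f U ∧ ∀ x ∈ U, ∀ m, ∑ j, fderiv ℝ f x (v j) * a m j = 0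

/-- `φ` gives a *Cauchy kernel* `K(y, x) = ‖y - x‖⁻ⁿ ∑ m, ± dy₁ ∧ ⋯ (omit dy_{i_m}) ⋯ ∧ dyₙ φ_m(x, y)`
for the conditions `a`, where `n = dim E` and the norm is the Euclidean norm of the coordinates in
the basis `v`: the `φ_m` are `C¹`, vanish on the diagonal, and `K` is a fundamental solution, that is,
`f(x) = - ∫ d''f(y) ∧ K(y, x)
  = - ∫ ‖y - x‖⁻ⁿ ∑ m, ∑ j, (∂f/∂y_j)(y) a_m^j φ_m(x, y) dy₁ ⋯ dyₙ`
for all test functions `f : E → A`.  The integral is written with `y = x + ∑ i, z_i v_i`. -/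
structure IsCauchyKernel {E A ι κ : Type*} [NormedAddCommGroup E] [NormedSpace ℝ E] [NormedRing A]
    [NormedAlgebra ℝ A] [Fintype ι] [Fintype κ] (v : Module.Basis ι ℝ E) (a : κ → ι → A)
    (φ : κ → E → E → A) : Prop where
  contDiff : ∀ m, ContDiff ℝ 1 (fun p : E × E => φ m p.1 p.2)
  diagonal : ∀ m x, φ m x x = 0
  reproducing : ∀ f : E → A, ContDiff ℝ ∞ f → HasCompactSupport f → ∀ x : E,
    f x = - ∫ z : EuclideanSpace ℝ ι, (‖z‖ ^ Fintype.card ι)⁻¹ •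
      ∑ m, ∑ j, fderiv ℝ f (x + ∑ i, z i • v i) (v j) * a m j * φ m x (x + ∑ i, z i • v i)

/-- The Cauchy conditions `a` are *admissible* if they admit a Cauchy kernel. -/
def AdmissibleConditions {E A ι κ : Type*} [NormedAddCommGroup E] [NormedSpace ℝ E] [NormedRing A]
    [NormedAlgebra ℝ A] [Fintype ι] [Fintype κ] (v : Module.Basis ι ℝ E) (a : κ → ι → A) : Prop :=
  ∃ φ : κ → E → E → A, IsCauchyKernel v a φ

/-- The real basis of `A^n` obtained by putting the basis `e` of `A` in each of the `n` factors. -/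
noncomputable def powBasis {A ι : Type*} [NormedRing A] [NormedAlgebra ℝ A] [Fintype ι]
    (n : ℕ) (e : Module.Basis ι ℝ A) : Module.Basis (Σ _ : Fin n, ι) ℝ (Fin n → A) :=
  Pi.basis fun _ => e

/-- The conditions on `A^n` *induced* by the conditions `a` on `A`: the condition of index `(l, m)`
is the `m`-th condition on `A`, imposed in the real coordinates of the `l`-th variable. -/
def inducedConditions {A ι κ : Type*} [NormedRing A] (n : ℕ) (a : κ → ι → A) :
    Fin n × κ → (Σ _ : Fin n, ι) → A :=
  fun p s => if s.1 = p.1 then a p.2 s.2 else 0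

/-- Bounded domains (non-empty connected open sets) with smooth boundary: near each boundary point,
`D` is given by `ρ < 0` for a smooth real function `ρ` with non-zero differential there. -/
structure IsSmoothBoundedDomain {E : Type*} [NormedAddCommGroup E] [NormedSpace ℝ E]
    (D : Set E) : Prop where
  isOpen : IsOpen D
  isConnected : IsConnected D
  isBounded : Bornology.IsBounded D
  smooth_boundary : ∀ p ∈ frontier D, ∃ (V : Set E) (ρ : E → ℝ), IsOpen V ∧ p ∈ V ∧
    ContDiffOn ℝ ∞ ρ V ∧ (∀ x ∈ V, fderiv ℝ ρ x ≠ 0) ∧ D ∩ V = {x ∈ V | ρ x < 0}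

/-! Put Ω = `D ∪ U` and K = `closure D \ U`: then K is compact, K ⊆ Ω and Ω \ K = U. The kernel
lives on one copy of `A`, so f is integrated over slices parallel to the first variable. On the
slice through x choose a plateau function χ, compactly supported in Ω, equal to 1 near K and to a
constant b near x; b = 1 is possible when x ∈ Ω, and b = 0 when x ∉ K. Pairing f with dχ and the
kernel uses f only on Ω \ K. By the reproducing formula for (χ - χ') f, two choices of χ give
integrals differing by (b - b') f(x) (`integral_sub_integral`). Hence there are C¹ functions F₁ on Ω
and F₀ off K, with F₁ - F₀ = f on Ω \ K and F₀ = 0 on every slice missing K.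

The kernel is not assumed to be Cauchy in x, so the conditions on F₁ and F₀ come from analytic
continuation. Admissibility yields Cauchy's estimate for first derivatives, hence power series along
lines and an identity theorem. A slice condition applied to F₁ and to F₀ gives functions that agree
on Ω \ K and glue to a function on the whole space. It is analytic along lines transverse to the
slices, where only the argument of f moves, and vanishes far out, so it is zero (`slice_ext`). Such
transverse lines exist because n ≥ 2. Now F₁ and F₀ are Cauchy on slices, and so are their
derivatives in every direction; the same argument along the slices gives all remaining conditions
(`isCauchyOn_ext`).

Finally, F₀ vanishes on a nonempty open part of U just beyond K (everywhere if K is empty), hence on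
the connected set U, and F₁ is the extension. -/

open scoped ContDiff
open scoped Topology
open Set Filter Metric MeasureTheory

/-! ### Cauchy's estimate, uniform limits and derivatives of Cauchy functions -/

section CauchyTheory

variable {E A ι κ : Type*} [NormedAddCommGroup E] [NormedSpace ℝ E] [NormedRing A]
    [NormedAlgebra ℝ A] [Fintype ι]

/-- The conditions `a` satisfy Cauchy's estimate for first derivatives. -/
def HasCauchyEstimate (v : Module.Basis ι ℝ E) (a : κ → ι → A) : Prop :=
  ∃ C : ℝ, 0 < C ∧ ∀ (f : E → A) (x : E) (r M : ℝ), 0 < r → IsCauchyOn v a f (ball x r) →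
    (∀ y ∈ ball x r, ‖f y‖ ≤ M) → ‖fderiv ℝ f x‖ ≤ C / r * M

variable {v : Module.Basis ι ℝ E} {a : κ → ι → A} {f g : E → A} {U V : Set E}

namespace IsCauchyOn

theorem differentiableAt (hf : IsCauchyOn v a f U) (hU : IsOpen U) {x : E} (hx : x ∈ U) :
    DifferentiableAt ℝ f x :=
  (hf.1.contDiffAt (hU.mem_nhds hx)).differentiableAt one_ne_zero

theorem mono (hf : IsCauchyOn v a f U) (h : V ⊆ U) : IsCauchyOn v a f V :=
  ⟨hf.1.mono h, fun x hx => hf.2 x (h hx)⟩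

theorem of_locally (h : ∀ x ∈ U, ∃ W ∈ 𝓝 x, IsCauchyOn v a f W) : IsCauchyOn v a f U := by
  refine ⟨fun x hx => ?_, fun x hx => ?_⟩
  · obtain ⟨W, hW, hfW⟩ := h x hx
    exact (hfW.1.contDiffAt hW).contDiffWithinAt
  · obtain ⟨W, hW, hfW⟩ := h x hx
    exact hfW.2 x (mem_of_mem_nhds hW)

theorem sub (hf : IsCauchyOn v a f U) (hg : IsCauchyOn v a g U) (hU : IsOpen U) :
    IsCauchyOn v a (fun x => f x - g x) U := by
  refine ⟨hf.1.sub hg.1, fun x hx m => ?_⟩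
  rw [fderiv_fun_sub (hf.differentiableAt hU hx) (hg.differentiableAt hU hx)]
  simp [sub_mul, Finset.sum_sub_distrib, hf.2 x hx m, hg.2 x hx m]

theorem const_smul (hf : IsCauchyOn v a f U) (hU : IsOpen U) (c : ℝ) :
    IsCauchyOn v a (fun x => c • f x) U := by
  refine ⟨hf.1.const_smul c, fun x hx m => ?_⟩
  rw [fderiv_fun_const_smul (hf.differentiableAt hU hx)]
  simp [← Finset.smul_sum, hf.2 x hx m]

/-- Cauchy functions are stable under homotheties and translations of the variable. -/
theorem comp_add_smul (hf : IsCauchyOn v a f U) (hU : IsOpen U) (p : E) (c : ℝ) :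
    IsCauchyOn v a (fun y => f (p + c • y)) {y | p + c • y ∈ U} := by
  have hA : ∀ y, HasFDerivAt (fun y : E => p + c • y) (c • ContinuousLinearMap.id ℝ E) y :=
    fun y => ((hasFDerivAt_id y).const_smul c).const_add p
  refine ⟨hf.1.comp (by fun_prop) fun y hy => hy, fun y hy m => ?_⟩
  have := ((hf.differentiableAt hU hy).hasFDerivAt.comp y (hA y)).fderiv
  simp only [Function.comp_def] at this
  rw [this]
  have h2 := hf.2 _ hy m
  simp only [ContinuousLinearMap.comp_smul, ContinuousLinearMap.comp_id,
    smul_apply, smul_mul_assoc, ← Finset.smul_sum, h2, smul_zero]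

end IsCauchyOn

/-- A uniform limit of Cauchy functions is a Cauchy function. -/
theorem IsCauchyOn.of_tendstoUniformlyOn [CompleteSpace A] (h : HasCauchyEstimate v a)
    {F : ℕ → E → A} {x : E} {R : ℝ}
    (hF : ∀ n, IsCauchyOn v a (F n) (ball x (2 * R)))
    (hlim : TendstoUniformlyOn F f atTop (ball x (2 * R))) : IsCauchyOn v a f (ball x R) := by
  rcases le_or_gt R 0 with hR | hR
  · rw [ball_eq_empty.2 hR]; exact ⟨contDiffOn_empty, by simp⟩
  obtain ⟨C, hC, hest⟩ := h
  have hsub : ∀ y ∈ ball x R, ball y R ⊆ ball x (2 * R) := fun y hy =>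
    ball_subset_ball' (by have := mem_ball.1 hy; linarith)
  have hmem : ∀ y ∈ ball x R, y ∈ ball x (2 * R) := fun y hy => hsub y hy (mem_ball_self hR)
  have hdiff : ∀ n, ∀ y ∈ ball x R, HasFDerivAt (F n) (fderiv ℝ (F n) y) y := fun n y hy =>
    ((hF n).differentiableAt isOpen_ball (hmem y hy)).hasFDerivAt
  have hcau : UniformCauchySeqOn (fun n => fderiv ℝ (F n)) atTop (ball x R) := by
    rw [Metric.uniformCauchySeqOn_iff]
    intro ε hε
    -- The estimate on `ball y R` multiplies this bound on `F m - F n` by `C / R`, which leaves `ε /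
    -- 2` for the difference of derivatives.
    have h1 := Metric.uniformCauchySeqOn_iff.1 hlim.uniformCauchySeqOn (ε * R / (2 * C))
      (by positivity)
    obtain ⟨N, hN⟩ := h1
    refine ⟨N, fun m hm n hn y hy => ?_⟩
    have hs := (((hF m).sub (hF n) isOpen_ball).mono (hsub y hy))
    have := hest _ y R (ε * R / (2 * C)) hR hs fun z hz => by
      rw [← dist_eq_norm]; exact (hN m hm n hn z (hsub y hy hz)).le
    rw [fderiv_fun_sub (hdiff m y hy).differentiableAt (hdiff n y hy).differentiableAt,
      ← dist_eq_norm] at this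
    refine this.trans_lt ?_
    have : C / R * (ε * R / (2 * C)) = ε / 2 := by field_simp
    rw [this]; linarith
  have hex : ∀ y ∈ ball x R, ∃ L, Tendsto (fun n => fderiv ℝ (F n) y) atTop (𝓝 L) :=
    fun y hy => cauchySeq_tendsto_of_complete (hcau.cauchySeq hy)
  choose! g' hg' using hex
  have hunif := hcau.tendstoUniformlyOn_of_tendsto hg'
  have hder : ∀ y ∈ ball x R, HasFDerivAt f (g' y) y := fun y hy =>
    hasFDerivAt_of_tendstoUniformlyOn isOpen_ball hunif hdiff
      (fun z hz => hlim.tendsto_at (hmem z hz)) hy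
  have hcont : ContinuousOn g' (ball x R) := by
    refine hunif.continuousOn (Eventually.frequently (Eventually.of_forall fun n => ?_))
    exact (((hF n).1.mono fun y hy => hmem y hy).continuousOn_fderiv_of_isOpen isOpen_ball le_rfl)
  refine ⟨?_, fun y hy m => ?_⟩
  · refine (contDiffOn_succ_iff_fderiv_of_isOpen (n := 0) isOpen_ball).2 ?_
    refine ⟨fun y hy => (hder y hy).differentiableAt.differentiableWithinAt, by simp,
      contDiffOn_zero.2 <| hcont.congr fun y hy => (hder y hy).fderiv⟩
  · rw [(hder y hy).fderiv]
    have h1 : Tendsto (fun n => ∑ j, fderiv ℝ (F n) y (v j) * a m j) atTop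
        (𝓝 (∑ j, g' y (v j) * a m j)) :=
      tendsto_finsetSum _ fun j _ => (((ContinuousLinearMap.apply ℝ A (v j)).continuous.tendsto
        _).comp (hg' y hy)).mul_const _
    refine tendsto_nhds_unique h1 ?_
    simp only [(hF _).2 y (hmem y hy) m, tendsto_const_nhds]

/-- Differentiating in any direction a `C¹` function whose slices are Cauchy functions gives a
function whose slices are Cauchy functions. -/
theorem IsCauchyOn.fderiv_slice [CompleteSpace A] (h : HasCauchyEstimate v a)
    {E' : Type*} [NormedAddCommGroup E'] [NormedSpace ℝ E'] [FiniteDimensional ℝ E']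
    {F : E' → A} {O : Set E'} (hO : IsOpen O) (hF : ContDiffOn ℝ 1 F O) (i : E →L[ℝ] E')
    (hs : ∀ p, IsCauchyOn v a (fun y => F (p + i y)) {y | p + i y ∈ O}) (w p : E') :
    IsCauchyOn v a (fun y => fderiv ℝ F (p + i y) w) {y | p + i y ∈ O} := by
  refine IsCauchyOn.of_locally fun y₀ hy₀ => ?_
  have := FiniteDimensional.proper_real E'
  obtain ⟨ρ, hρ, hρO⟩ := Metric.isOpen_iff.1 hO _ hy₀
  set x₀ := p + i y₀ with hx₀
  have hK : IsCompact (closedBall x₀ (ρ / 2)) := isCompact_closedBall _ _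
  have hKO : closedBall x₀ (ρ / 2) ⊆ O := (closedBall_subset_ball (by linarith)).trans hρO
  have huc : UniformContinuousOn (fderiv ℝ F) (closedBall x₀ (ρ / 2)) :=
    hK.uniformContinuousOn_of_continuous
      ((hF.continuousOn_fderiv_of_isOpen hO le_rfl).mono hKO)
  obtain ⟨R, hR, hRi⟩ : ∃ R > 0, ∀ y ∈ ball y₀ (2 * R), p + i y ∈ ball x₀ (ρ / 4) := by
    have hc : Continuous fun y => p + i y := by fun_prop
    obtain ⟨R, hR, h⟩ := Metric.mem_nhds_iff.1
      (hc.continuousAt.preimage_mem_nhds (ball_mem_nhds (p + i y₀) (show 0 < ρ / 4 by positivity)))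
    exact ⟨R / 2, by positivity, fun y hy => h (by rwa [mul_div_cancel₀ _ two_ne_zero] at hy)⟩
  obtain ⟨N₀, hN₀⟩ : ∃ N₀ : ℕ, ‖w‖ / (N₀ + 1) < ρ / 4 := by
    obtain ⟨N, hN⟩ := exists_nat_gt (‖w‖ / (ρ / 4))
    refine ⟨N, ?_⟩
    rw [div_lt_iff₀ (by positivity)] at hN ⊢
    nlinarith
  -- Starting at `N₀` keeps every segment from `p + i y` to `p + i y + t n • w` inside the compact
  -- ball where `fderiv ℝ F` is uniformly continuous.
  set t : ℕ → ℝ := fun n => 1 / ((N₀ + n : ℕ) + 1 : ℝ) with ht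
  have htpos : ∀ n, 0 < t n := fun n => by simp only [ht]; positivity
  have htw : ∀ n, ‖t n • w‖ < ρ / 4 := fun n => by
    rw [norm_smul, Real.norm_of_nonneg (htpos n).le]
    refine lt_of_le_of_lt ?_ hN₀
    simp only [ht]
    rw [one_div, div_eq_inv_mul]
    gcongr
    simp
  have ht0 : Tendsto t atTop (𝓝 0) := by
    have := tendsto_one_div_add_atTop_nhds_zero_nat (𝕜 := ℝ)
    exact this.comp (tendsto_atTop_mono (fun n => Nat.le_add_left n N₀) tendsto_id)
  have hmemb : ∀ y ∈ ball y₀ (2 * R), ∀ n, ∀ s ∈ Icc (0 : ℝ) 1,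
      p + i y + s • (t n • w) ∈ closedBall x₀ (ρ / 2) := fun y hy n s hs => by
    have h1 := mem_ball.1 (hRi y hy)
    rw [mem_closedBall]
    calc dist (p + i y + s • (t n • w)) x₀
        ≤ dist (p + i y + s • (t n • w)) (p + i y) + dist (p + i y) x₀ := dist_triangle _ _ _
      _ ≤ ρ / 4 + ρ / 4 := by
        gcongr
        rw [dist_self_add_left, norm_smul, Real.norm_of_nonneg hs.1]
        exact (mul_le_of_le_one_left (norm_nonneg _) hs.2).trans (htw n).le
      _ = ρ / 2 := by ring
  refine ⟨ball y₀ R, ball_mem_nhds _ hR, ?_⟩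
  -- The difference quotients in direction `w` are Cauchy because a translate of a slice is again a
  -- slice; the mean value inequality makes them converge uniformly to the derivative.
  refine IsCauchyOn.of_tendstoUniformlyOn h
    (F := fun n y => (t n)⁻¹ • (F (p + t n • w + i y) - F (p + i y))) (fun n => ?_) ?_
  · refine IsCauchyOn.const_smul (IsCauchyOn.sub ?_ ?_ isOpen_ball) isOpen_ball _
    · refine (hs _).mono fun y hy => ?_
      have := hKO (hmemb y hy n 1 (by simp))
      simpa [add_right_comm] using this
    · exact (hs _).mono fun y hy => by
        have := hKO (hmemb y hy n 0 (by simp))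
        simpa using this
  · rw [Metric.tendstoUniformlyOn_iff]
    intro ε hε
    obtain ⟨δ, hδ, hd⟩ := Metric.uniformContinuousOn_iff.1 huc (ε / (‖w‖ + 1)) (by positivity)
    have hsmall : ∀ᶠ n in atTop, ‖t n • w‖ < δ := by
      have : Tendsto (fun n => ‖t n • w‖) atTop (𝓝 0) := by
        simpa using (ht0.smul_const w).norm
      exact this.eventually_lt_const hδ
    filter_upwards [hsmall] with n hn y hy
    have hconv : Convex ℝ (segment ℝ (p + i y) (p + i y + t n • w)) := convex_segment _ _
    have hseg : ∀ z ∈ segment ℝ (p + i y) (p + i y + t n • w),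
        z ∈ closedBall x₀ (ρ / 2) ∧ dist z (p + i y) < δ := by
      intro z hz
      rw [segment_eq_image'] at hz
      obtain ⟨s, hs, rfl⟩ := hz
      simp only [add_sub_cancel_left]
      refine ⟨hmemb y hy n s hs, ?_⟩
      rw [dist_self_add_left, norm_smul, Real.norm_of_nonneg hs.1]
      exact (mul_le_of_le_one_left (norm_nonneg _) hs.2).trans_lt hn
    have hmv := hconv.norm_image_sub_le_of_norm_hasFDerivWithin_le'
      (f := F) (f' := fderiv ℝ F) (φ := fderiv ℝ F (p + i y)) (C := ε / (‖w‖ + 1))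
      (fun z hz => ((hF.contDiffAt (hO.mem_nhds (hKO (hseg z hz).1))).differentiableAt
        one_ne_zero).hasFDerivAt.hasFDerivWithinAt)
      (fun z hz => by
        rw [← dist_eq_norm]
        refine (hd z (hseg z hz).1 _ ?_ (hseg z hz).2).le
        simpa using hmemb y hy n 0 (by simp))
      (left_mem_segment ℝ _ _) (right_mem_segment ℝ _ _)
    rw [dist_comm, dist_eq_norm]
    have e1 : (t n)⁻¹ • (F (p + t n • w + i y) - F (p + i y)) - fderiv ℝ F (p + i y) w
        = (t n)⁻¹ • (F (p + i y + t n • w) - F (p + i y)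
          - fderiv ℝ F (p + i y) (p + i y + t n • w - (p + i y))) := by
      rw [add_right_comm p, add_sub_cancel_left, map_smul, smul_sub _ _ (t n • _), smul_smul,
        inv_mul_cancel₀ (htpos n).ne', one_smul]
    simp only [e1]
    rw [norm_smul, norm_inv, Real.norm_of_nonneg (htpos n).le]
    calc (t n)⁻¹ * _ ≤ (t n)⁻¹ * (ε / (‖w‖ + 1) * ‖t n • w‖) := by
          have := (inv_pos.2 (htpos n)).le
          gcongr
          simpa using hmv
      _ = ε * (‖w‖ / (‖w‖ + 1)) := by
          rw [norm_smul, Real.norm_of_nonneg (htpos n).le]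
          have := (htpos n).ne'
          field_simp
      _ < ε := by
          refine mul_lt_of_lt_one_right hε ?_
          rw [div_lt_one (by positivity)]; linarith

/-- The case where `E` is its own single slice. It can be iterated, which produces derivatives of
all orders from `C¹` regularity. -/
theorem IsCauchyOn.fderiv_apply [CompleteSpace A] [FiniteDimensional ℝ E]
    (h : HasCauchyEstimate v a) (hU : IsOpen U) (hf : IsCauchyOn v a f U) (w : E) :
    IsCauchyOn v a (fun x => fderiv ℝ f x w) U := by
  have := IsCauchyOn.fderiv_slice h hU hf.1 (ContinuousLinearMap.id ℝ E)
    (fun p => by simpa using hf.comp_add_smul hU p 1) w 0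
  simpa using this

end CauchyTheory

/-! ### Taylor's formula with remainder -/

section Taylor

variable {A : Type*} [NormedAddCommGroup A] [NormedSpace ℝ A]

/-- When the base point `s` varies with `t` fixed, the derivative telescopes and only the top term
survives. -/
theorem hasDerivAt_taylor_sum {g : ℕ → ℝ → A} {t s : ℝ}
    (hg : ∀ i, HasDerivAt (g i) (g (i + 1) s) s) (n : ℕ) :
    HasDerivAt (fun s => ∑ i ∈ Finset.range (n + 1), ((t - s) ^ i / i.factorial) • g i s)
      (((t - s) ^ n / n.factorial) • g (n + 1) s) s := by
  induction n with
  | zero => simpa using hg 0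
  | succ n ih =>
    simp_rw [Finset.sum_range_succ _ (n + 1)]
    have h1 : HasDerivAt (fun s : ℝ => (t - s) ^ (n + 1) / ((n + 1).factorial : ℝ))
        (-((t - s) ^ n / n.factorial)) s := by
      have := (((hasDerivAt_id s).const_sub t).pow (n + 1)).div_const ((n + 1).factorial : ℝ)
      refine this.congr_deriv ?_
      have : ((n + 1).factorial : ℝ) = (n + 1) * n.factorial := by
        rw [Nat.factorial_succ]; push_cast; ring
      rw [this]
      have h2 : (n.factorial : ℝ) ≠ 0 := by positivity
      have h3 : (n + 1 : ℝ) ≠ 0 := by positivity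
      simp only [id, Nat.cast_add, Nat.cast_one, Nat.add_sub_cancel]
      field_simp
    refine (ih.add (h1.smul (hg (n + 1)))).congr_deriv ?_
    simp only [neg_smul]
    abel

/-- Taylor's formula for a sequence of successive derivatives. -/
theorem norm_sub_taylor_sum_le {g : ℕ → ℝ → A} {t B : ℝ} (n : ℕ)
    (hg : ∀ i, ∀ s ∈ segment ℝ 0 t, HasDerivAt (g i) (g (i + 1) s) s)
    (hB : ∀ s ∈ segment ℝ 0 t, ‖g (n + 1) s‖ ≤ B) :
    ‖g 0 t - ∑ i ∈ Finset.range (n + 1), (t ^ i / i.factorial) • g i 0‖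
      ≤ |t| ^ (n + 1) / n.factorial * B := by
  have hB0 : 0 ≤ B := (norm_nonneg _).trans (hB 0 (left_mem_segment ℝ _ _))
  have key := (convex_segment (𝕜 := ℝ) (0 : ℝ) t).norm_image_sub_le_of_norm_hasDerivWithin_le
    (f := fun s => ∑ i ∈ Finset.range (n + 1), ((t - s) ^ i / i.factorial) • g i s)
    (f' := fun s => ((t - s) ^ n / n.factorial) • g (n + 1) s)
    -- The mean value inequality gives `n!` where the sharp remainder has `(n + 1)!`. The lost
    -- factor `n + 1` is harmless against geometric decay.
    (C := |t| ^ n / n.factorial * B)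
    (fun s hs => (hasDerivAt_taylor_sum (fun i => hg i s hs) n).hasDerivWithinAt)
    (fun s hs => by
      rw [norm_smul, norm_div, norm_pow, Real.norm_natCast]
      have : ‖t - s‖ ≤ |t| := by
        rw [segment_eq_image'] at hs
        obtain ⟨θ, hθ, rfl⟩ := hs
        have : t - (0 + θ • (t - 0)) = (1 - θ) * t := by simp; ring
        rw [this, norm_mul, Real.norm_eq_abs t, Real.norm_of_nonneg (by linarith [hθ.2])]
        exact mul_le_of_le_one_left (abs_nonneg _) (by linarith [hθ.1])
      gcongr
      exact hB s hs)
    (left_mem_segment ℝ _ _) (right_mem_segment ℝ _ _)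
  have e1 : ∑ i ∈ Finset.range (n + 1), ((t - t) ^ i / (i.factorial : ℝ)) • g i t = g 0 t := by
    rw [Finset.sum_range_succ']
    simp
  simp only [e1, sub_zero] at key
  refine key.trans (le_of_eq ?_)
  rw [Real.norm_eq_abs]; ring

end Taylor

/-! ### Analyticity on lines and the identity theorem -/

section CauchyAnalytic

variable {E A ι κ : Type*} [NormedAddCommGroup E] [NormedSpace ℝ E] [NormedRing A]
    [NormedAlgebra ℝ A] [Fintype ι] {v : Module.Basis ι ℝ E} {a : κ → ι → A} {f g : E → A}
    {U V : Set E}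

/-- The `N`-th derivative in the direction `w`. -/
noncomputable def iterDirDeriv (f : E → A) (w : E) : ℕ → E → A
  | 0 => f
  | N + 1 => fun x => fderiv ℝ (iterDirDeriv f w N) x w

theorem IsCauchyOn.isCauchyOn_iterDirDeriv [CompleteSpace A] [FiniteDimensional ℝ E]
    (h : HasCauchyEstimate v a) (hU : IsOpen U) (hf : IsCauchyOn v a f U) (w : E) (N : ℕ) :
    IsCauchyOn v a (iterDirDeriv f w N) U := by
  induction N with
  | zero => exact hf
  | succ N ih => exact ih.fderiv_apply h hU w

/-- Each derivative spends one radius `r` through the estimate on `ball y r`, so `N` derivatives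
need room `N * r`. -/
theorem IsCauchyOn.norm_iterDirDeriv_le [CompleteSpace A] [FiniteDimensional ℝ E] {C : ℝ}
    (h : HasCauchyEstimate v a)
    (hest : ∀ (f : E → A) (x : E) (r M : ℝ), 0 < r → IsCauchyOn v a f (ball x r) →
      (∀ y ∈ ball x r, ‖f y‖ ≤ M) → ‖fderiv ℝ f x‖ ≤ C / r * M)
    (hU : IsOpen U) (hf : IsCauchyOn v a f U) (w : E) {M r : ℝ} (hr : 0 < r)
    (hM : ∀ y ∈ U, ‖f y‖ ≤ M) (N : ℕ) :
    ∀ y ∈ U, ball y (N * r) ⊆ U → ‖iterDirDeriv f w N y‖ ≤ (C / r * ‖w‖) ^ N * M := by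
  induction N with
  | zero => intro y hy _; simpa [iterDirDeriv] using hM y hy
  | succ N ih =>
    intro y hy hyU
    have hyr : ball y r ⊆ U := (ball_subset_ball (by
      push_cast; nlinarith [Nat.cast_nonneg (α := ℝ) N])).trans hyU
    have := hest _ y r ((C / r * ‖w‖) ^ N * M) hr ((hf.isCauchyOn_iterDirDeriv h hU w N).mono hyr)
      fun z hz => ih z (hyr hz) ((ball_subset_ball' (by
        have := mem_ball.1 hz; push_cast; linarith)).trans hyU)
    calc ‖iterDirDeriv f w (N + 1) y‖
        ≤ ‖fderiv ℝ (iterDirDeriv f w N) y‖ * ‖w‖ := ContinuousLinearMap.le_opNorm _ _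
      _ ≤ C / r * ((C / r * ‖w‖) ^ N * M) * ‖w‖ := by gcongr
      _ = _ := by ring

/-- Power series expansion of a Cauchy function on a line, with uniform bounds. -/
theorem HasCauchyEstimate.exists_hasSum_line [CompleteSpace A] [FiniteDimensional ℝ E]
    (h : HasCauchyEstimate v a) (w : E) : ∃ C : ℝ, 0 < C ∧ ∀ (f : E → A) (x : E) (δ M : ℝ), 0 < δ →
      IsCauchyOn v a f (ball x (2 * δ)) → (∀ y ∈ ball x (2 * δ), ‖f y‖ ≤ M) →
      (∀ N, ‖((N.factorial : ℝ)⁻¹) • iterDirDeriv f w N x‖ ≤ M * (C / δ) ^ N) ∧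
      ∀ t : ℝ, |t| < δ / C →
        HasSum (fun N => t ^ N • ((N.factorial : ℝ)⁻¹ • iterDirDeriv f w N x)) (f (x + t • w)) := by
  obtain ⟨C₀, hC₀, hest⟩ := id h
  -- Taking `N` derivatives with radius `δ / N` costs a factor `N ^ N`, and `N ^ N ≤ N! * e ^ N`
  -- explains `Real.exp 1`. The added ones make the constant positive and at least `‖w‖`, so that
  -- `|t| < δ / C` keeps `x + t • w` in `ball x δ`.
  refine ⟨(C₀ + 1) * (‖w‖ + 1) * Real.exp 1, by positivity, fun f x δ M hδ hf hM => ?_⟩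
  set C := (C₀ + 1) * (‖w‖ + 1) * Real.exp 1 with hCdef
  have hC : 0 < C := by positivity
  clear_value C
  have hM0 : 0 ≤ M := (norm_nonneg _).trans (hM x (mem_ball_self (by positivity)))
  have bound : ∀ N : ℕ, ∀ y ∈ ball x δ,
      ‖iterDirDeriv f w N y‖ ≤ N.factorial * (M * (C / δ) ^ N) := by
    intro N y hy
    have hyU : y ∈ ball x (2 * δ) := ball_subset_ball (by linarith) hy
    rcases Nat.eq_zero_or_pos N with rfl | hN
    · simpa [iterDirDeriv] using hM y hyU
    have hN' : (0 : ℝ) < N := by exact_mod_cast hN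
    have := hf.norm_iterDirDeriv_le h hest isOpen_ball w (r := δ / N) (by positivity) hM N y
      hyU (by
        rw [mul_div_cancel₀ _ hN'.ne']
        exact ball_subset_ball' (by have := mem_ball.1 hy; linarith))
    refine this.trans ?_
    have hNN : (N : ℝ) ^ N ≤ N.factorial * Real.exp 1 ^ N := by
      have := Real.pow_div_factorial_le_exp (N : ℝ) hN'.le N
      rw [div_le_iff₀ (by positivity)] at this
      rw [← Real.exp_nat_mul, mul_one]; linarith
    calc (C₀ / (δ / N) * ‖w‖) ^ N * M = (C₀ * ‖w‖ / δ) ^ N * (N : ℝ) ^ N * M := by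
          rw [← mul_pow]; congr 2; field_simp
      _ ≤ ((C₀ + 1) * (‖w‖ + 1) / δ) ^ N * (N.factorial * Real.exp 1 ^ N) * M := by
          gcongr <;> linarith
      _ = N.factorial * (M * (C / δ) ^ N) := by
          have : C / δ = (C₀ + 1) * (‖w‖ + 1) / δ * Real.exp 1 := by rw [hCdef]; ring
          rw [this, mul_pow]; ring
  have bound' : ∀ N : ℕ, ‖((N.factorial : ℝ)⁻¹) • iterDirDeriv f w N x‖ ≤ M * (C / δ) ^ N := by
    intro N
    have hf : (0 : ℝ) < N.factorial := by positivity
    rw [norm_smul, norm_inv, Real.norm_natCast, inv_mul_le_iff₀ hf]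
    exact bound N x (mem_ball_self hδ)
  refine ⟨bound', fun t ht => ?_⟩
  have hθ : C * |t| / δ < 1 := by
    rw [lt_div_iff₀ hC] at ht
    rw [div_lt_one hδ]; linarith
  have hθ0 : 0 ≤ C * |t| / δ := by positivity
  have hsum : Summable fun N => t ^ N • ((N.factorial : ℝ)⁻¹ • iterDirDeriv f w N x) := by
    refine Summable.of_norm_bounded (g := fun N => M * (C * |t| / δ) ^ N)
      ((summable_geometric_of_lt_one hθ0 hθ).mul_left M) fun N => ?_
    rw [norm_smul, norm_pow, Real.norm_eq_abs]
    calc |t| ^ N * _ ≤ |t| ^ N * (M * (C / δ) ^ N) := by gcongr; exact bound' N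
      _ = M * (C * |t| / δ) ^ N := by rw [mul_div_right_comm, mul_pow]; ring
  have htw : ∀ s ∈ segment ℝ 0 t, x + s • w ∈ ball x δ := by
    intro s hs
    rw [segment_eq_image'] at hs
    obtain ⟨θ, hθ, rfl⟩ := hs
    simp only [zero_add, sub_zero, smul_eq_mul]
    rw [mem_ball, dist_self_add_left, norm_smul, norm_mul,
      Real.norm_of_nonneg hθ.1, Real.norm_eq_abs]
    have h1 : θ * |t| ≤ |t| := mul_le_of_le_one_left (abs_nonneg _) hθ.2
    have h2 : ‖w‖ ≤ C := by
      have : 1 ≤ Real.exp 1 := Real.one_le_exp zero_le_one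
      calc ‖w‖ ≤ 1 * (‖w‖ + 1) * 1 := by linarith
        _ ≤ C := by rw [hCdef]; gcongr; linarith
    calc θ * |t| * ‖w‖ ≤ |t| * C := by gcongr
      _ < δ := by rwa [lt_div_iff₀ hC] at ht
  refine (hsum.hasSum_iff_tendsto_nat).2 ?_
  rw [← tendsto_add_atTop_iff_nat 1, tendsto_iff_norm_sub_tendsto_zero]
  have hlim : Tendsto (fun n : ℕ => M * ((n + 1 : ℕ) * (C * |t| / δ) ^ (n + 1))) atTop (𝓝 0) := by
    have := ((tendsto_self_mul_const_pow_of_lt_one hθ0 hθ).comp (tendsto_add_atTop_nat 1)).const_mul M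
    simpa using this
  refine squeeze_zero (fun _ => norm_nonneg _) (fun n => ?_) hlim
  have hder : ∀ i, ∀ s ∈ segment ℝ 0 t, HasDerivAt (fun s : ℝ => iterDirDeriv f w i (x + s • w))
      (iterDirDeriv f w (i + 1) (x + s • w)) s := by
    intro i s hs
    have h1 : HasFDerivAt (iterDirDeriv f w i) _ (x + s • w) :=
      ((hf.isCauchyOn_iterDirDeriv h isOpen_ball w i).differentiableAt isOpen_ball
        (ball_subset_ball (by linarith) (htw s hs))).hasFDerivAt
    have h2 : HasDerivAt (fun s : ℝ => x + s • w) w s := by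
      simpa using ((hasDerivAt_id s).smul_const w).const_add x
    exact h1.comp_hasDerivAt s h2
  have := norm_sub_taylor_sum_le n hder fun s hs => bound (n + 1) _ (htw s hs)
  rw [norm_sub_rev]
  have e : ∀ i : ℕ, t ^ i • ((i.factorial : ℝ)⁻¹ • iterDirDeriv f w i x) =
      (t ^ i / i.factorial) • iterDirDeriv f w i (x + (0 : ℝ) • w) := fun i => by
    rw [smul_smul, zero_smul, add_zero, div_eq_mul_inv]
  simp only [e]
  refine this.trans (le_of_eq ?_)
  have hn : ((n + 1).factorial : ℝ) = (n + 1 : ℕ) * n.factorial := by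
    rw [Nat.factorial_succ]; push_cast; ring
  rw [hn, mul_div_right_comm, mul_pow]
  have h2 : (n.factorial : ℝ) ≠ 0 := by positivity
  field_simp

theorem analyticAt_of_hasSum {F : Type*} [NormedAddCommGroup F] [NormedSpace ℝ F] {g : ℝ → F}
    {c : ℕ → F} {r : ℝ} (hr : 0 < r)
    (h : ∀ t, |t| < r → HasSum (fun N => t ^ N • c N) (g t)) : AnalyticAt ℝ g 0 := by
  let p : FormalMultilinearSeries ℝ ℝ F := fun n =>
    ContinuousMultilinearMap.mkPiRing ℝ (Fin n) (c n)
  refine ⟨p, hasFPowerSeriesAt_iff.2 ?_⟩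
  filter_upwards [ball_mem_nhds (0 : ℝ) hr] with t ht
  simpa [FormalMultilinearSeries.coeff, p] using h t (by simpa using ht)

/-- An integral superposition of Cauchy functions is analytic on lines. -/
theorem IsCauchyOn.analyticAt_integral_line [CompleteSpace A] [FiniteDimensional ℝ E]
    (h : HasCauchyEstimate v a) (hU : IsOpen U) (hf : IsCauchyOn v a f U) (w : E)
    {Z : Type*} [TopologicalSpace Z] [T2Space Z] [SecondCountableTopology Z]
    [MeasurableSpace Z] [BorelSpace Z] {μ : Measure Z}
    [IsFiniteMeasureOnCompacts μ] {S : Set Z} (hS : IsCompact S) {q : Z → E}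
    (hq : ContinuousOn q S) (hqU : ∀ z ∈ S, q z ∈ U) {k : Z → A} (hk : ContinuousOn k S)
    (hk0 : ∀ z ∉ S, k z = 0) :
    AnalyticAt ℝ (fun t : ℝ => ∫ z, f (q z + t • w) * k z ∂μ) 0 := by
  obtain ⟨C, hC, hexp⟩ := h.exists_hasSum_line w
  have := FiniteDimensional.proper_real E
  -- A compact thickening of the image of `S` gives one bound on `f` and one radius of convergence
  -- for all `z`; the expansions can then be integrated termwise by dominated convergence.
  obtain ⟨ε, hε, hεU⟩ := (hS.image_of_continuousOn hq).exists_cthickening_subset_open hU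
    (by rintro _ ⟨z, hz, rfl⟩; exact hqU z hz)
  obtain ⟨M, hM⟩ := ((hS.image_of_continuousOn hq).cthickening (r := ε)).exists_bound_of_continuousOn
    (hf.1.continuousOn.mono hεU)
  have hball : ∀ z ∈ S, ball (q z) (2 * (ε / 2)) ⊆ cthickening ε (q '' S) := fun z hz => by
    rw [mul_div_cancel₀ _ two_ne_zero]
    exact (ball_subset_thickening (mem_image_of_mem q hz) ε).trans (thickening_subset_cthickening _ _)
  have hexp' := fun z hz => hexp f (q z) (ε / 2) M (by positivity)
    (hf.mono ((hball z hz).trans hεU)) (fun y hy => hM y (hball z hz hy))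
  obtain ⟨M', hM'⟩ := hS.exists_bound_of_continuousOn hk
  have hint : ∀ g : Z → A, ∫ z, g z * k z ∂μ = ∫ z in S, g z * k z ∂μ := fun g =>
    (setIntegral_eq_integral_of_forall_compl_eq_zero fun z hz => by simp [hk0 z hz]).symm
  have hfin : IsFiniteMeasure (μ.restrict S) := ⟨by simpa using hS.measure_lt_top⟩
  simp only [hint (fun z => f (q z + _ • w))]
  refine analyticAt_of_hasSum (r := ε / 2 / C) (by positivity)
    (c := fun N => ∫ z in S, ((N.factorial : ℝ)⁻¹ • iterDirDeriv f w N (q z)) * k z ∂μ)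
    fun t ht => ?_
  have hθ : C * |t| / (ε / 2) < 1 := by
    rw [lt_div_iff₀ hC] at ht
    rw [div_lt_one (by positivity)]; linarith
  have hθ0 : 0 ≤ C * |t| / (ε / 2) := by positivity
  simp only [← integral_smul]
  have hS' := ae_restrict_mem (μ := μ) hS.measurableSet
  have hsm := (summable_geometric_of_lt_one hθ0 hθ).mul_left M |>.mul_right M'
  refine hasSum_integral_of_dominated_convergence
    (bound := fun N _ => M * (C * |t| / (ε / 2)) ^ N * M') (fun N => ?_) (fun N => ?_) ?_ ?_ ?_
  · refine ContinuousOn.aestronglyMeasurable ?_ hS.measurableSet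
    have hc : ContinuousOn (fun z => iterDirDeriv f w N (q z)) S :=
      (hf.isCauchyOn_iterDirDeriv h hU w N).1.continuousOn.comp hq hqU
    exact ((hc.const_smul _).mul hk).const_smul _
  · filter_upwards [hS'] with z hz
    rw [norm_smul, norm_pow, Real.norm_eq_abs]
    have h1 := (hexp' z hz).1 N
    have hM0 : 0 ≤ M := (norm_nonneg _).trans (hM (q z) (hball z hz (mem_ball_self (by positivity))))
    calc _ ≤ |t| ^ N * (M * (C / (ε / 2)) ^ N * M') := by
          gcongr
          exact (norm_mul_le _ _).trans (mul_le_mul h1 (hM' z hz) (norm_nonneg _) (by positivity))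
      _ = _ := by rw [mul_div_right_comm C, mul_pow]; ring
  · exact Eventually.of_forall fun _ => hsm
  · exact integrable_const _
  · filter_upwards [hS'] with z hz
    simpa only [smul_mul_assoc] using ((hexp' z hz).2 t ht).mul_right (k z)

theorem IsCauchyOn.analyticAt_line [CompleteSpace A] [FiniteDimensional ℝ E]
    (h : HasCauchyEstimate v a) (hU : IsOpen U) (hf : IsCauchyOn v a f U) {x w : E} {t : ℝ}
    (hx : x + t • w ∈ U) : AnalyticAt ℝ (fun t : ℝ => f (x + t • w)) t := by
  obtain ⟨C, hC, hexp⟩ := h.exists_hasSum_line w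
  have := FiniteDimensional.proper_real E
  obtain ⟨ε, hε, hεU⟩ := Metric.nhds_basis_closedBall.mem_iff.1 (hU.mem_nhds hx)
  obtain ⟨M, hM⟩ := (isCompact_closedBall (x + t • w) ε).exists_bound_of_continuousOn
    (hf.1.continuousOn.mono hεU)
  have hb : ball (x + t • w) (2 * (ε / 2)) ⊆ closedBall (x + t • w) ε := by
    rw [mul_div_cancel₀ _ two_ne_zero]; exact ball_subset_closedBall
  have h0 : AnalyticAt ℝ (fun s : ℝ => f (x + t • w + s • w)) (t - t) := by
    rw [sub_self]
    exact analyticAt_of_hasSum (r := ε / 2 / C) (by positivity)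
      (hexp f _ (ε / 2) M (by positivity) (hf.mono (hb.trans hεU)) fun y hy => hM y (hb hy)).2
  have h1 : AnalyticAt ℝ (fun s : ℝ => s - t) t := by fun_prop
  refine (h0.fun_comp (f := fun s : ℝ => s - t) h1).congr (Eventually.of_forall fun s => ?_)
  simp only
  rw [add_assoc, ← add_smul, add_sub_cancel]

/-- The identity theorem for Cauchy functions. -/
theorem IsCauchyOn.eqOn_zero_of_preconnected [CompleteSpace A] [FiniteDimensional ℝ E]
    (h : HasCauchyEstimate v a) (hU : IsOpen U) (hUc : IsPreconnected U)
    (hf : IsCauchyOn v a f U) {z : E} (hz : z ∈ U) (hfz : f =ᶠ[𝓝 z] 0) : EqOn f 0 U := by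
  have hopen : IsOpen {x | f =ᶠ[𝓝 x] 0} := isOpen_iff_mem_nhds.2 fun x hx =>
    eventually_eventually_nhds.2 hx
  have hsub := hUc.subset_of_closure_inter_subset hopen ⟨z, hz, hfz⟩ ?_
  · exact fun x hx => (hsub hx).self_of_nhds
  rintro x ⟨hx, hxU⟩
  obtain ⟨r, hr, hrU⟩ := Metric.isOpen_iff.1 hU x hxU
  -- The lines through `x₀` sweep out `ball x₀ (r / 2)`, which contains `x`; on each of them `f` is
  -- analytic and vanishes near `x₀`.
  obtain ⟨x₀, hx₀, hd⟩ := Metric.mem_closure_iff.1 hx (r / 2) (by positivity)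
  have hbU : ball x₀ (r / 2) ⊆ U := (ball_subset_ball' (by rw [dist_comm]; linarith)).trans hrU
  have hzero : ∀ y ∈ ball x₀ (r / 2), f y = 0 := by
    intro y hy
    have hcont : Continuous fun t : ℝ => x₀ + t • (y - x₀) := by fun_prop
    have hconv : Convex ℝ {t : ℝ | x₀ + t • (y - x₀) ∈ ball x₀ (r / 2)} := by
      have := (convex_ball x₀ (r / 2)).affine_preimage (AffineMap.lineMap (k := ℝ) x₀ y)
      refine (congrArg (Convex ℝ) (Set.ext fun t => ?_)).mp this
      simp [AffineMap.lineMap_apply, add_comm]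
    have han : AnalyticOnNhd ℝ (fun t : ℝ => f (x₀ + t • (y - x₀)))
        {t : ℝ | x₀ + t • (y - x₀) ∈ ball x₀ (r / 2)} := fun t ht =>
      hf.analyticAt_line h hU (hbU ht)
    have hev : (fun t : ℝ => f (x₀ + t • (y - x₀))) =ᶠ[𝓝 0] 0 := by
      have : Tendsto (fun t : ℝ => x₀ + t • (y - x₀)) (𝓝 0) (𝓝 x₀) := by
        simpa using hcont.tendsto 0
      exact this.eventually hx₀
    have := han.eqOn_zero_of_preconnected_of_eventuallyEq_zero hconv.isPreconnected (z₀ := 0)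
      (by simpa using hr) hev (x := 1) (by simpa [← dist_eq_norm] using hy)
    simpa using this
  exact Filter.mem_of_superset (isOpen_ball.mem_nhds (mem_ball.2 hd)) hzero

end CauchyAnalytic

/-! ### Mollification and plateau functions -/

section Smoothing

variable {E F : Type*} [NormedAddCommGroup E] [NormedSpace ℝ E] [FiniteDimensional ℝ E]
  [NormedAddCommGroup F] [NormedSpace ℝ F] [CompleteSpace F]

/-- Approximation of compactly supported `C¹` functions by test functions: values and derivatives
converge uniformly, and linear relations between first derivatives are preserved locally. -/
theorem exists_contDiff_approx {g : E → F} (hg : ContDiff ℝ 1 g) (hgc : HasCompactSupport g) :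
    ∃ G : ℕ → E → F, (∀ n, ContDiff ℝ ∞ (G n)) ∧ (∀ n, HasCompactSupport (G n)) ∧
      (∀ x, Tendsto (fun n => G n x) atTop (𝓝 (g x))) ∧
      (∀ ε > 0, ∀ᶠ n in atTop, ∀ y, ‖fderiv ℝ (G n) y - fderiv ℝ g y‖ ≤ ε) ∧
      ∀ r > 0, ∀ᶠ n in atTop, ∀ y, ∀ Λ : (E →L[ℝ] F) →L[ℝ] F,
        (∀ z ∈ ball y r, Λ (fderiv ℝ g z) = 0) → Λ (fderiv ℝ (G n) y) = 0 := by
  let _ : MeasurableSpace E := borel E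
  have : BorelSpace E := ⟨rfl⟩
  have := FiniteDimensional.proper_real E
  let μ : Measure E := Measure.addHaar
  let φ : ℕ → ContDiffBump (0 : E) := fun n =>
    ⟨1 / (2 * ((n : ℝ) + 1)), 1 / ((n : ℝ) + 1), by positivity, by
      apply one_div_lt_one_div_of_lt (by positivity); linarith [Nat.cast_nonneg (α := ℝ) n]⟩
  have hout : ∀ n, (φ n).rOut = 1 / ((n : ℝ) + 1) := fun n => rfl
  have hlim : Tendsto (fun n => (φ n).rOut) atTop (𝓝 0) := tendsto_one_div_add_atTop_nhds_zero_nat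
  have hg' : Continuous (fderiv ℝ g) := hg.continuous_fderiv one_ne_zero
  have hg'c : HasCompactSupport (fderiv ℝ g) := hgc.fderiv ℝ
  have hder : ∀ n y, fderiv ℝ (convolution ((φ n).normed μ) g (ContinuousLinearMap.lsmul ℝ ℝ) μ) y
      = convolution ((φ n).normed μ) (fderiv ℝ g) (ContinuousLinearMap.lsmul ℝ ℝ) μ y := by
    intro n y
    rw [(hgc.hasFDerivAt_convolution_right (ContinuousLinearMap.lsmul ℝ ℝ)
      ((φ n).continuous_normed.locallyIntegrable (μ := μ)) hg y).fderiv]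
    simp only [convolution]
    refine integral_congr_ae (Eventually.of_forall fun t => ?_)
    ext w
    simp [ContinuousLinearMap.precompR_apply]
  refine ⟨fun n => convolution ((φ n).normed μ) g (ContinuousLinearMap.lsmul ℝ ℝ) μ,
    fun n => ?_, fun n => ?_, fun x => ?_, fun ε hε => ?_, fun r hr => ?_⟩
  · exact (φ n).hasCompactSupport_normed.contDiff_convolution_left _ (φ n).contDiff_normed
      hg.continuous.locallyIntegrable
  · exact (φ n).hasCompactSupport_normed.convolution _ hgc
  · exact ContDiffBump.convolution_tendsto_right_of_continuous hlim hg.continuous x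
  · have huc := hg'c.uniformContinuous_of_continuous hg'
    obtain ⟨δ, hδ, hd⟩ := Metric.uniformContinuous_iff.1 huc ε hε
    filter_upwards [hlim.eventually_lt_const hδ] with n hn y
    rw [hder, ← dist_eq_norm]
    exact ContDiffBump.dist_normed_convolution_le hg'.aestronglyMeasurable
      fun z hz => (hd ((mem_ball.1 hz).trans hn)).le
  -- The derivative of the mollified function is an average of `fderiv ℝ g` over a ball of radius
  -- `rOut`, so a linear relation valid on `ball y r` survives once `rOut < r`.
  · filter_upwards [hlim.eventually_lt_const hr] with n hn y Λ hΛ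
    rw [hder]
    simp only [convolution, ContinuousLinearMap.lsmul_apply]
    rw [← ContinuousLinearMap.integral_comp_comm]
    · refine integral_eq_zero_of_ae (Eventually.of_forall fun t => ?_)
      simp only [map_smul, Pi.zero_apply]
      by_cases ht : t ∈ ball (0 : E) (φ n).rOut
      · rw [hΛ _ (by
          rw [mem_ball, dist_self_sub_left]
          exact (mem_ball_zero_iff.1 ht).trans hn), smul_zero]
      · have : (φ n).normed μ t = 0 := by
          rw [← Function.notMem_support, (φ n).support_normed_eq]; exact ht
        rw [this, zero_smul]
    · refine Continuous.integrable_of_hasCompactSupport ?_ ?_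
      · exact (φ n).continuous_normed.smul (hg'.comp (by fun_prop))
      · exact (φ n).hasCompactSupport_normed.smul_right

/-- A compact subset of an open set has a smooth plateau function supported in the open set. -/
theorem exists_contDiff_plateau {C O : Set E} (hC : IsCompact C) (hO : IsOpen O) (hCO : C ⊆ O) :
    ∃ χ : E → ℝ, ContDiff ℝ ∞ χ ∧ HasCompactSupport χ ∧ tsupport χ ⊆ O ∧
      ∀ y ∈ C, χ =ᶠ[𝓝 y] fun _ => 1 := by
  have := FiniteDimensional.proper_real E
  obtain ⟨L, hL, hCL, hLO⟩ := exists_compact_between hC hO hCO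
  obtain ⟨χ, h1, h0, -⟩ := exists_contMDiffMap_one_nhds_of_subset_interior (n := ⊤)
    (modelWithCornersSelf ℝ E) hC.isClosed hCL
  have hsub : tsupport χ ⊆ L := closure_minimal (fun y hy => by
    by_contra h; exact hy (h0 y h)) hL.isClosed
  refine ⟨χ, χ.contMDiff.contDiff, hL.of_isClosed_subset (isClosed_tsupport _) hsub,
    hsub.trans hLO, fun y hy => ?_⟩
  exact (eventually_nhdsSet_iff_forall.1 h1) y hy

end Smoothing

/-! ### Differentiation under the integral sign -/

section ParametricIntegral

variable {P Z B : Type*} [NormedAddCommGroup P] [NormedSpace ℝ P] [NormedAddCommGroup Z]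
  [NormedSpace ℝ Z] [MeasurableSpace Z] [BorelSpace Z] [FiniteDimensional ℝ Z]
  [NormedAddCommGroup B] [NormedSpace ℝ B]
  {μ : Measure Z} [μ.IsAddHaarMeasure] {g : P → Z → B} {s : Set P} {k : Set Z}

/-- The integral is the convolution of the constant 1 with `g p`, evaluated at 0, so
differentiability of convolutions with a parameter applies. -/
theorem hasFDerivAt_integral_of_isCompact (hs : IsOpen s)
    (hk : IsCompact k) (hgs : ∀ p ∈ s, ∀ z ∉ k, g p z = 0)
    (hg : ∀ p ∈ s, ∀ z, ContDiffAt ℝ 1 (fun q : P × Z => g q.1 q.2) (p, z)) {p : P} (hp : p ∈ s) :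
    ∃ L : P →L[ℝ] B, HasFDerivAt (fun p => ∫ z, g p z ∂μ) L p ∧
      ∀ w, L w = ∫ z, fderiv ℝ (fun p => g p z) p w ∂μ := by
  have hg1 : ContDiffOn ℝ 1 (↿g) (s ×ˢ univ) := fun q hq => (hg q.1 hq.1 q.2).contDiffWithinAt
  have hconv : ∀ p, convolution (fun _ : Z => (1 : ℝ)) (g p) (ContinuousLinearMap.lsmul ℝ ℝ) μ 0
      = ∫ z, g p z ∂μ := by
    intro p
    simp only [convolution, ContinuousLinearMap.lsmul_apply, one_smul, zero_sub]
    exact integral_neg_eq_self (g p) μ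
  have h := hasFDerivAt_convolution_right_with_param (ContinuousLinearMap.lsmul ℝ ℝ) hs hk
    (fun p z hp hz => hgs p hp z hz)
    ((continuous_const (y := (1 : ℝ))).locallyIntegrable (μ := μ)) hg1 (p, (0 : Z)) hp
  have hi : HasFDerivAt (fun p : P => (p, (0 : Z))) (ContinuousLinearMap.inl ℝ P Z) p :=
    hasFDerivAt_prodMk_left p 0
  have h2 := h.comp p hi
  simp only [Function.comp_def, hconv] at h2
  refine ⟨_, h2, fun w => ?_⟩
  have hcont : Continuous fun z => fderiv ℝ (↿g) (p, z) :=
    (hg1.continuousOn_fderiv_of_isOpen (hs.prod isOpen_univ) le_rfl).comp_continuous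
      (by fun_prop) fun z => ⟨hp, mem_univ _⟩
  have hzero : ∀ z ∉ k, fderiv ℝ (↿g) (p, z) = 0 := by
    intro z hz
    have : (↿g) =ᶠ[𝓝 (p, z)] fun _ => 0 := by
      filter_upwards [(hs.prod hk.isClosed.isOpen_compl).mem_nhds ⟨hp, hz⟩] with q hq
      exact hgs q.1 hq.1 q.2 hq.2
    rw [this.fderiv_eq]; simp
  have hint : Integrable (fun z => fderiv ℝ (↿g) (p, z)) μ :=
    hcont.integrable_of_hasCompactSupport (HasCompactSupport.intro hk hzero)
  have hpt : ∀ z, fderiv ℝ (↿g) (p, z) (w, 0) = fderiv ℝ (fun p => g p z) p w := by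
    intro z
    have h3 : HasFDerivAt (↿g) (fderiv ℝ (↿g) (p, z)) (p, z) :=
      ((hg p hp z).differentiableAt one_ne_zero).hasFDerivAt
    have h4 := h3.comp (f := fun e : P => (e, z)) p (hasFDerivAt_prodMk_left p z)
    have h5 := h4.fderiv
    simp only [Function.comp_def] at h5
    have h6 : fderiv ℝ (fun p => g p z) p = _ := h5
    rw [h6]; simp
  simp only [← hpt]
  have e1 : (convolution (fun _ : Z => (1 : ℝ)) (fun z => fderiv ℝ (↿g) (p, z))
      (ContinuousLinearMap.precompR (P × Z) (ContinuousLinearMap.lsmul ℝ ℝ)) μ 0 :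
        P × Z →L[ℝ] B) = ∫ z, fderiv ℝ (↿g) (p, z) ∂μ := by
    rw [← integral_neg_eq_self]
    simp only [convolution, zero_sub]
    exact integral_congr_ae (Eventually.of_forall fun t =>
      ContinuousLinearMap.ext fun u => by simp [ContinuousLinearMap.precompR_apply])
  rw [ContinuousLinearMap.comp_apply, e1, ContinuousLinearMap.inl_apply]
  exact ContinuousLinearMap.integral_apply hint _

theorem contDiffOn_integral_of_isCompact (hs : IsOpen s)
    (hk : IsCompact k) (hgs : ∀ p ∈ s, ∀ z ∉ k, g p z = 0)
    (hg : ∀ p ∈ s, ∀ z, ContDiffAt ℝ 1 (fun q : P × Z => g q.1 q.2) (p, z)) :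
    ContDiffOn ℝ 1 (fun p => ∫ z, g p z ∂μ) s := by
  have hg1 : ContDiffOn ℝ 1 (↿g) (s ×ˢ univ) := fun q hq => (hg q.1 hq.1 q.2).contDiffWithinAt
  have h := contDiffOn_convolution_right_with_param (n := 1) (ContinuousLinearMap.lsmul ℝ ℝ) hs hk
    (fun p z hp hz => hgs p hp z hz)
    ((continuous_const (y := (1 : ℝ))).locallyIntegrable (μ := μ)) hg1
  have h2 : ContDiffOn ℝ 1 (fun p : P => (p, (0 : Z))) s := by fun_prop
  refine (h.comp h2 fun p hp => ⟨hp, mem_univ _⟩).congr fun p _ => ?_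
  simp only [Function.comp_def, convolution, ContinuousLinearMap.lsmul_apply, one_smul, zero_sub]
  exact (integral_neg_eq_self (g p) μ).symm

end ParametricIntegral

/-! ### The Cauchy kernel and plateau functions -/

section Kernel

variable {E A ι κ : Type*} [NormedAddCommGroup E] [NormedSpace ℝ E]
    [NormedRing A] [NormedAlgebra ℝ A] [Fintype ι] [Fintype κ]
    {v : Module.Basis ι ℝ E} {a : κ → ι → A} {φ : κ → E → E → A}

/-- The parametrization of `E` by Euclidean coordinates in the basis `v`. -/
noncomputable def coordEquiv (v : Module.Basis ι ℝ E) : EuclideanSpace ℝ ι ≃L[ℝ] E :=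
  (EuclideanSpace.equiv ι ℝ).trans v.equivFunL.symm

theorem coordEquiv_apply (z : EuclideanSpace ℝ ι) : coordEquiv v z = ∑ i, z i • v i :=
  v.equivFun_symm_apply _

/-- The reproducing formula holds for `C¹` functions with compact support, at the points near which
they are Cauchy functions. -/
theorem IsCauchyKernel.reproducing_of_contDiff_one [FiniteDimensional ℝ E] [CompleteSpace A]
    (hφ : IsCauchyKernel v a φ) {g : E → A} (hg : ContDiff ℝ 1 g) (hgc : HasCompactSupport g)
    {x : E} (hx : ∀ m, ∀ᶠ y in 𝓝 x, ∑ j, fderiv ℝ g y (v j) * a m j = 0) :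
    g x = - ∫ z : EuclideanSpace ℝ ι, (‖z‖ ^ Fintype.card ι)⁻¹ •
      ∑ m, ∑ j, fderiv ℝ g (x + coordEquiv v z) (v j) * a m j * φ m x (x + coordEquiv v z) := by
  have := FiniteDimensional.proper_real E
  obtain ⟨G, hG, hGc, hGlim, hGu, hGloc⟩ := exists_contDiff_approx hg hgc
  obtain ⟨r, hr, hxr⟩ := Metric.eventually_nhds_iff_ball.1 (eventually_all.2 hx)
  have hg' : Continuous (fderiv ℝ g) := hg.continuous_fderiv one_ne_zero
  have hrep : ∀ n, G n x = - ∫ z : EuclideanSpace ℝ ι, (‖z‖ ^ Fintype.card ι)⁻¹ •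
      ∑ m, ∑ j, fderiv ℝ (G n) (x + coordEquiv v z) (v j) * a m j *
        φ m x (x + coordEquiv v z) := fun n => by
    simpa only [coordEquiv_apply] using hφ.reproducing (G n) (hG n) (hGc n) x
  obtain ⟨B, hB⟩ := hg'.bounded_above_of_compact_support (hgc.fderiv ℝ)
  set Q : Set E := cthickening 1 (tsupport g) with hQ
  have hQc : IsCompact Q := IsCompact.cthickening hgc
  -- For large `n` the integrands vanish off `S`: outside `Q` because `G n` is locally zero, and
  -- near `x` because `G n` inherits the conditions there. The singularity `z = 0` is thus avoided,
  -- and domination takes place on a compact set.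
  set S : Set (EuclideanSpace ℝ ι) := {z | x + coordEquiv v z ∈ Q ∧ r / 2 ≤ ‖coordEquiv v z‖} with hS
  have hSc : IsCompact S := by
    have h1 : IsCompact ((fun z => x + coordEquiv v z) ⁻¹' Q) :=
      (((coordEquiv v).toHomeomorph.trans (Homeomorph.addLeft x)).isClosedEmbedding).isCompact_preimage
        hQc
    exact h1.inter_right (isClosed_le continuous_const (coordEquiv v).continuous.norm)
  have hS0 : ∀ z ∈ S, z ≠ 0 := by
    rintro z hz rfl
    have := hz.2
    simp only [map_zero, norm_zero] at this
    linarith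
  have hφc : ∀ m, Continuous fun z : EuclideanSpace ℝ ι => φ m x (x + coordEquiv v z) := fun m =>
    (hφ.contDiff m).continuous.comp (by fun_prop : Continuous fun z => (x, x + coordEquiv v z))
  set bd : EuclideanSpace ℝ ι → ℝ := S.indicator fun z => (‖z‖ ^ Fintype.card ι)⁻¹ *
    ∑ m, ∑ j, (B + 1) * ‖v j‖ * ‖a m j‖ * ‖φ m x (x + coordEquiv v z)‖ with hbd
  have hbdint : Integrable bd := by
    rw [hbd, integrable_indicator_iff hSc.measurableSet]
    refine ContinuousOn.integrableOn_compact hSc ?_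
    refine ContinuousOn.mul (ContinuousOn.inv₀ (by fun_prop) fun z hz => ?_) ?_
    · exact pow_ne_zero _ (norm_ne_zero_iff.2 (hS0 z hz))
    · exact Continuous.continuousOn <| continuous_finsetSum _ fun m _ =>
        continuous_finsetSum _ fun j _ => continuous_const.mul (hφc m).norm
  have h1 : ∀ᶠ n in atTop, ∀ z, ‖(‖z‖ ^ Fintype.card ι)⁻¹ •
      ∑ m, ∑ j, fderiv ℝ (G n) (x + coordEquiv v z) (v j) * a m j *
        φ m x (x + coordEquiv v z)‖ ≤ bd z := by
    filter_upwards [hGu 1 one_pos, hGloc 1 one_pos, hGloc (r / 2) (by positivity)] with n hn1 hn2 hn3 z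
    by_cases hz : z ∈ S
    · rw [hbd, indicator_of_mem hz, norm_smul, norm_inv, norm_pow, norm_norm]
      gcongr
      refine (norm_sum_le _ _).trans (Finset.sum_le_sum fun m _ =>
        (norm_sum_le _ _).trans (Finset.sum_le_sum fun j _ => ?_))
      have hle : ‖fderiv ℝ (G n) (x + coordEquiv v z)‖ ≤ B + 1 := by
        have h1 := hn1 (x + coordEquiv v z)
        have h2 := hB (x + coordEquiv v z)
        have h3 := norm_le_norm_add_norm_sub' (fderiv ℝ (G n) (x + coordEquiv v z))
          (fderiv ℝ g (x + coordEquiv v z))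
        linarith
      refine (norm_mul_le _ _).trans ?_
      gcongr
      refine (norm_mul_le _ _).trans ?_
      gcongr
      exact (ContinuousLinearMap.le_opNorm _ _).trans (by gcongr)
    · rw [hbd, indicator_of_notMem hz]
      refine le_of_eq ?_
      rw [norm_eq_zero]
      rw [smul_eq_zero]
      right
      simp only [hS, mem_ofPred_eq, not_and_or, not_le] at hz
      simp only [← Finset.sum_mul]
      refine Finset.sum_eq_zero fun m _ => ?_
      rcases hz with hz | hz
      · have : ∀ j, fderiv ℝ (G n) (x + coordEquiv v z) (v j) = 0 := by
          intro j
          refine hn2 _ (ContinuousLinearMap.apply ℝ A (v j)) fun y hy => ?_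
          have : y ∉ tsupport g := by
            intro hyt
            apply hz
            refine mem_cthickening_of_dist_le _ y 1 _ hyt ?_
            rw [dist_comm]
            exact (mem_ball.1 hy).le
          have h0 : fderiv ℝ g y = 0 := by
            by_contra h
            exact this (support_fderiv_subset ℝ h)
          simp [h0]
        simp [this]
      · let Λ : (E →L[ℝ] A) →L[ℝ] A :=
          ∑ j, ((ContinuousLinearMap.mul ℝ A).flip (a m j)).comp (ContinuousLinearMap.apply ℝ A (v j))
        have hΛ : ∀ L, Λ L = ∑ j, L (v j) * a m j := fun L => by
          simp [Λ, sum_apply]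
        have := hn3 (x + coordEquiv v z) Λ fun y hy => by
          rw [hΛ]
          refine hxr y ?_ m
          rw [mem_ball] at hy ⊢
          calc dist y x ≤ dist y (x + coordEquiv v z) + dist (x + coordEquiv v z) x :=
                dist_triangle _ _ _
            _ < r / 2 + r / 2 := by rw [dist_self_add_left]; gcongr
            _ = r := by ring
        rw [hΛ] at this
        rw [this, zero_mul]
  have h2 : Tendsto (fun n => ∫ z : EuclideanSpace ℝ ι, (‖z‖ ^ Fintype.card ι)⁻¹ •
      ∑ m, ∑ j, fderiv ℝ (G n) (x + coordEquiv v z) (v j) * a m j *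
        φ m x (x + coordEquiv v z)) atTop (𝓝 (∫ z : EuclideanSpace ℝ ι, (‖z‖ ^ Fintype.card ι)⁻¹ •
      ∑ m, ∑ j, fderiv ℝ g (x + coordEquiv v z) (v j) * a m j *
        φ m x (x + coordEquiv v z))) := by
    refine tendsto_integral_filter_of_dominated_convergence bd (Eventually.of_forall fun n => ?_)
      (h1.mono fun n hn => Eventually.of_forall hn) hbdint (Eventually.of_forall fun z => ?_)
    · refine AEStronglyMeasurable.smul ?_ (Continuous.aestronglyMeasurable ?_)
      · exact Measurable.aestronglyMeasurable (by fun_prop)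
      · refine continuous_finsetSum _ fun m _ => continuous_finsetSum _ fun j _ => ?_
        have hGn : Continuous (fderiv ℝ (G n)) := (hG n).continuous_fderiv (by simp)
        exact (((hGn.comp (by fun_prop)).clm_apply continuous_const).mul continuous_const).mul
          (hφc m)
    · refine Tendsto.const_smul (tendsto_finsetSum _ fun m _ => tendsto_finsetSum _ fun j _ => ?_) _
      have h3 : Tendsto (fun n => fderiv ℝ (G n) (x + coordEquiv v z)) atTop
          (𝓝 (fderiv ℝ g (x + coordEquiv v z))) := by
        rw [Metric.tendsto_nhds]
        intro ε hε
        filter_upwards [hGu (ε / 2) (by positivity)] with n hn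
        rw [dist_eq_norm]
        exact (hn _).trans_lt (by linarith)
      have h4 := ((ContinuousLinearMap.apply ℝ A (v j)).continuous.tendsto _).comp h3
      exact (h4.mul_const _).mul_const _
  have h3 : Tendsto (fun n => G n x) atTop (𝓝 (- ∫ z : EuclideanSpace ℝ ι, (‖z‖ ^ Fintype.card ι)⁻¹ •
      ∑ m, ∑ j, fderiv ℝ g (x + coordEquiv v z) (v j) * a m j *
        φ m x (x + coordEquiv v z))) := by
    simpa only [hrep] using h2.neg
  exact tendsto_nhds_unique (hGlim x) h3

/-- The Cauchy kernel paired with the differential of a plateau function `χ`. -/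
noncomputable def plateauKernel (v : Module.Basis ι ℝ E) (a : κ → ι → A) (φ : κ → E → E → A)
    (χ : E → ℝ) (x y : E) : A :=
  -((‖(coordEquiv v).symm (y - x)‖ ^ Fintype.card ι)⁻¹ •
    ∑ m, ∑ j, fderiv ℝ χ y (v j) • (a m j * φ m x y))

theorem plateauKernel_eq_zero {χ : E → ℝ} {x y : E} (hy : fderiv ℝ χ y = 0) :
    plateauKernel v a φ χ x y = 0 := by
  simp [plateauKernel, hy]

theorem plateauKernel_eq_zero_of_notMem {χ : E → ℝ} {x y : E} (hy : y ∉ tsupport (fderiv ℝ χ)) :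
    plateauKernel v a φ χ x y = 0 :=
  plateauKernel_eq_zero (image_eq_zero_of_notMem_tsupport hy)

/-- The singularity `y = x` lies where `dχ` vanishes identically. -/
theorem IsCauchyKernel.contDiffAt_plateauKernel (hφ : IsCauchyKernel v a φ) {χ : E → ℝ}
    (hχ : ContDiff ℝ ∞ χ) {x : E} (hx : ∀ᶠ y in 𝓝 x, fderiv ℝ χ y = 0) (y : E) :
    ContDiffAt ℝ 1 (fun p : E × E => plateauKernel v a φ χ p.1 p.2) (x, y) := by
  by_cases hxy : y = x
  · subst hxy
    have : (fun p : E × E => plateauKernel v a φ χ p.1 p.2) =ᶠ[𝓝 (y, y)] fun _ => 0 := by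
      have h2 : Tendsto (fun p : E × E => p.2) (𝓝 (y, y)) (𝓝 y) := continuous_snd.tendsto (y, y)
      filter_upwards [h2.eventually hx] with p hp
      exact plateauKernel_eq_zero hp
    exact contDiffAt_const.congr_of_eventuallyEq this
  · have hne : (coordEquiv v).symm (y - x) ≠ 0 := by
      simpa [sub_eq_zero] using hxy
    have h1 : ContDiffAt ℝ 1 (fun p : E × E => (coordEquiv v).symm (p.2 - p.1)) (x, y) :=
      (coordEquiv v).symm.contDiff.contDiffAt.comp (x, y) (contDiffAt_snd.sub contDiffAt_fst)
    have h2 := ((h1.norm ℝ hne).pow (Fintype.card ι)).inv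
      (pow_ne_zero _ (norm_ne_zero_iff.2 hne))
    have h3 : ContDiff ℝ 1 (fderiv ℝ χ) := hχ.fderiv_right (by norm_cast)
    have h4 : ContDiffAt ℝ 1 (fun p : E × E =>
        ∑ m, ∑ j, fderiv ℝ χ p.2 (v j) • (a m j * φ m p.1 p.2)) (x, y) :=
      ContDiffAt.sum fun m _ => ContDiffAt.sum fun j _ =>
        ((h3.contDiffAt.comp (x, y) contDiffAt_snd).clm_apply contDiffAt_const).smul
          (contDiffAt_const.mul (hφ.contDiff m).contDiffAt)
    exact (h2.smul h4).neg

/-- Cauchy functions are reproduced by the kernel on the locus where `χ` is locally constant. -/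
theorem IsCauchyKernel.smul_eq_integral [FiniteDimensional ℝ E] [CompleteSpace A]
    (hφ : IsCauchyKernel v a φ) {χ : E → ℝ} (hχ : ContDiff ℝ ∞ χ) (hχc : HasCompactSupport χ)
    {f : E → A} {W : Set E} (hW : IsOpen W) (hf : IsCauchyOn v a f W) (hχW : tsupport χ ⊆ W)
    {x : E} (hx : ∀ᶠ y in 𝓝 x, fderiv ℝ χ y = 0) :
    χ x • f x = ∫ z : EuclideanSpace ℝ ι, f (coordEquiv v z) *
      plateauKernel v a φ χ x (coordEquiv v z) := by
  have hχ1 : ContDiff ℝ 1 χ := hχ.of_le (by norm_cast)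
  have hzero : ∀ y ∉ tsupport χ, (fun y => χ y • f y) =ᶠ[𝓝 y] fun _ => 0 := by
    intro y hy
    filter_upwards [(isClosed_tsupport χ).isOpen_compl.mem_nhds hy] with z hz
    rw [image_eq_zero_of_notMem_tsupport hz, zero_smul]
  have hg : ContDiff ℝ 1 (fun y => χ y • f y) := contDiff_iff_contDiffAt.2 fun y => by
    by_cases hy : y ∈ tsupport χ
    · exact hχ1.contDiffAt.smul (hf.1.contDiffAt (hW.mem_nhds (hχW hy)))
    · exact contDiffAt_const.congr_of_eventuallyEq (hzero y hy)
  -- In Leibniz's rule the terms with `χ` times a derivative of `f` cancel by the Cauchy conditions.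
  -- The derivatives of `χ` are real scalars, so `f` stays on the left.
  have hL : ∀ m y, ∑ j, fderiv ℝ (fun y => χ y • f y) y (v j) * a m j =
      ∑ j, fderiv ℝ χ y (v j) • (f y * a m j) := by
    intro m y
    by_cases hy : y ∈ tsupport χ
    · rw [fderiv_fun_smul (hχ1.differentiable one_ne_zero y) (hf.differentiableAt hW (hχW hy))]
      simp [add_mul, Finset.sum_add_distrib, ← Finset.smul_sum, hf.2 y (hχW hy) m]
    · have h0 : fderiv ℝ χ y = 0 := by
        by_contra h
        exact hy (support_fderiv_subset ℝ h)
      rw [(hzero y hy).fderiv_eq, h0]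
      simp
  have key := hφ.reproducing_of_contDiff_one hg hχc.smul_right (x := x) fun m => by
    filter_upwards [hx] with y hy
    rw [hL, hy]; simp
  refine key.trans ?_
  rw [← integral_neg, ← integral_add_left_eq_self (fun z : EuclideanSpace ℝ ι =>
    f (coordEquiv v z) * plateauKernel v a φ χ x (coordEquiv v z)) ((coordEquiv v).symm x)]
  refine integral_congr_ae (Eventually.of_forall fun z => ?_)
  simp only [map_add, ContinuousLinearEquiv.apply_symm_apply, plateauKernel, add_sub_cancel_left,
    ContinuousLinearEquiv.symm_apply_apply, mul_neg, mul_smul_comm, Finset.mul_sum,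
    ← Finset.sum_mul, hL]
  simp only [Finset.sum_mul, smul_mul_assoc, mul_assoc]

end Kernel

/-! ### Admissible conditions satisfy Cauchy's estimate -/

section Estimate

variable {E A ι κ : Type*} [NormedAddCommGroup E] [NormedSpace ℝ E]
    [NormedRing A] [NormedAlgebra ℝ A] [Fintype ι]
    {v : Module.Basis ι ℝ E} {a : κ → ι → A}

theorem isCompact_coordEquiv_preimage {Q : Set E} (hQ : IsCompact Q) :
    IsCompact (coordEquiv v ⁻¹' Q) :=
  ((coordEquiv v).toHomeomorph.isClosedEmbedding).isCompact_preimage hQ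

theorem isCauchyOn_slice {E' : Type*} [NormedAddCommGroup E'] [NormedSpace ℝ E'] {f : E' → A}
    {U : Set E'} (hU : IsOpen U) (hf : ContDiffOn ℝ 1 f U) (s : E →L[ℝ] E')
    (h : ∀ x ∈ U, ∀ m, ∑ j, fderiv ℝ f x (s (v j)) * a m j = 0) (p : E') :
    IsCauchyOn v a (fun y => f (p + s y)) {y | p + s y ∈ U} := by
  refine ⟨hf.comp (by fun_prop) fun y hy => hy, fun y hy m => ?_⟩
  have h1 : HasFDerivAt (fun y => p + s y) s y := s.hasFDerivAt.const_add p
  have h2 := (((hf.contDiffAt (hU.mem_nhds hy)).differentiableAt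
    one_ne_zero).hasFDerivAt.comp y h1).fderiv
  simp only [Function.comp_def] at h2
  rw [h2]
  exact h _ hy m

/-- By translation and dilation, Cauchy's estimate on the unit ball implies it on all balls. -/
theorem HasCauchyEstimate.of_unit_ball {C : ℝ} (hC : 0 < C)
    (h : ∀ (f : E → A) (M : ℝ), IsCauchyOn v a f (ball 0 1) → (∀ y ∈ ball (0 : E) 1, ‖f y‖ ≤ M) →
      ‖fderiv ℝ f 0‖ ≤ C * M) : HasCauchyEstimate v a := by
  refine ⟨C, hC, fun f x r M hr hf hM => ?_⟩
  have hmem : ∀ y ∈ ball (0 : E) 1, x + r • y ∈ ball x r := fun y hy => by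
    rw [mem_ball, dist_self_add_left, norm_smul, Real.norm_of_nonneg hr.le]
    have := mem_ball_zero_iff.1 hy
    nlinarith
  have := h (fun y => f (x + r • y)) M ((hf.comp_add_smul isOpen_ball x r).mono hmem)
    fun y hy => hM _ (hmem y hy)
  have hA : HasFDerivAt (fun y : E => x + r • y) (r • ContinuousLinearMap.id ℝ E) 0 :=
    ((hasFDerivAt_id (0 : E)).const_smul r).const_add x
  have hd : HasFDerivAt f (fderiv ℝ f x) (x + r • (0 : E)) := by
    rw [smul_zero, add_zero]
    exact (hf.differentiableAt isOpen_ball (mem_ball_self hr)).hasFDerivAt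
  have h2 := (hd.comp (0 : E) hA).fderiv
  simp only [Function.comp_def] at h2
  rw [h2, ContinuousLinearMap.comp_smul, ContinuousLinearMap.comp_id, norm_smul,
    Real.norm_of_nonneg hr.le] at this
  rw [div_mul_eq_mul_div, le_div_iff₀ hr]
  linarith

/-- With `χ = 1` near the half ball, `f` is there an integral of its own values against a kernel
that is `C¹`, hence uniformly Lipschitz, in `x`. So `f` is Lipschitz at 0 with constant proportional
to `M`, and this bounds its derivative. -/
theorem AdmissibleConditions.hasCauchyEstimate [Fintype κ] [FiniteDimensional ℝ E] [CompleteSpace A]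
    (ha : AdmissibleConditions v a) : HasCauchyEstimate v a := by
  obtain ⟨φ, hφ⟩ := ha
  have := FiniteDimensional.proper_real E
  obtain ⟨χ, hχ, hχc, hχU, hχ1⟩ := exists_contDiff_plateau
    (isCompact_closedBall (0 : E) (1 / 2)) isOpen_ball
    (closedBall_subset_ball (show (1 / 2 : ℝ) < 1 by norm_num))
  have hloc : ∀ x ∈ closedBall (0 : E) (1 / 2), ∀ᶠ y in 𝓝 x, fderiv ℝ χ y = 0 := fun x hx => by
    filter_upwards [eventually_eventually_nhds.2 (hχ1 x hx)] with y hy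
    have : χ =ᶠ[𝓝 y] fun _ => 1 := hy
    rw [this.fderiv_eq]; simp
  set k : E → EuclideanSpace ℝ ι → A := fun x z => plateauKernel v a φ χ x (coordEquiv v z) with hk
  set S : Set (EuclideanSpace ℝ ι) := coordEquiv v ⁻¹' tsupport χ with hS
  have hSc : IsCompact S := isCompact_coordEquiv_preimage hχc
  have hk0 : ∀ x, ∀ z ∉ S, k x z = 0 := fun x z hz => by
    refine plateauKernel_eq_zero ?_
    by_contra h
    exact hz (support_fderiv_subset ℝ h)
  have hkd : ∀ x ∈ closedBall (0 : E) (1 / 2), ∀ z,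
      ContDiffAt ℝ 1 (fun p : E × EuclideanSpace ℝ ι => k p.1 p.2) (x, z) := fun x hx z =>
    (hφ.contDiffAt_plateauKernel hχ (hloc x hx) (coordEquiv v z)).comp
      (f := fun p : E × EuclideanSpace ℝ ι => (p.1, coordEquiv v p.2)) (x, z)
      (contDiffAt_fst.prodMk ((coordEquiv v).contDiff.contDiffAt.comp (x, z) contDiffAt_snd))
  have hkcont : ∀ x ∈ closedBall (0 : E) (1 / 2), Continuous (k x) := fun x hx =>
    continuous_iff_continuousAt.2 fun z =>
      ((hkd x hx z).continuousAt).comp (f := fun z => (x, z)) (by fun_prop)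
  have hcomp : IsCompact (closedBall (0 : E) (1 / 2) ×ˢ S) := (isCompact_closedBall _ _).prod hSc
  obtain ⟨B, hB⟩ := hcomp.exists_bound_of_continuousOn
    (f := fderiv ℝ fun p : E × EuclideanSpace ℝ ι => k p.1 p.2) fun p hp =>
      ((hkd p.1 hp.1 p.2).continuousAt_fderiv one_ne_zero).continuousWithinAt
  have hlip : ∀ x ∈ closedBall (0 : E) (1 / 2), ∀ z, ‖k x z - k 0 z‖ ≤ |B| * ‖x‖ := by
    intro x hx z
    by_cases hz : z ∈ S
    · have h1 : ∀ y ∈ closedBall (0 : E) (1 / 2), HasFDerivWithinAt (fun y => k y z)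
          ((fderiv ℝ (fun p : E × EuclideanSpace ℝ ι => k p.1 p.2) (y, z)).comp
            (ContinuousLinearMap.inl ℝ E (EuclideanSpace ℝ ι))) (closedBall 0 (1 / 2)) y := by
        intro y hy
        exact ((((hkd y hy z).differentiableAt one_ne_zero).hasFDerivAt).comp
          (f := fun y : E => (y, z)) y (hasFDerivAt_prodMk_left y z)).hasFDerivWithinAt
      have := (convex_closedBall (0 : E) (1 / 2)).norm_image_sub_le_of_norm_hasFDerivWithin_le h1
        (C := |B|) (fun y hy => ?_) (mem_closedBall_self (by norm_num)) hx
      · simpa using this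
      · refine (ContinuousLinearMap.opNorm_comp_le _ _).trans ?_
        calc _ ≤ |B| * 1 := by
              gcongr
              · exact (hB (y, z) ⟨hy, hz⟩).trans (le_abs_self B)
              · exact ContinuousLinearMap.norm_inl_le_one ℝ E _
          _ = |B| := mul_one _
    · simp only [hk0 _ z hz, sub_self, norm_zero]; positivity
  set V : ℝ := volume.real S with hV
  refine HasCauchyEstimate.of_unit_ball (C := |B| * V + 1) (by positivity) fun f M hf hM => ?_
  have hM0 : 0 ≤ M := (norm_nonneg _).trans (hM 0 (mem_ball_self one_pos))
  have hfS : ContinuousOn (fun z => f (coordEquiv v z)) S :=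
    hf.1.continuousOn.comp (coordEquiv v).continuous.continuousOn fun z hz => hχU hz
  have hrep : ∀ x ∈ closedBall (0 : E) (1 / 2),
      f x = ∫ z in S, f (coordEquiv v z) * k x z := by
    intro x hx
    have h1 := hφ.smul_eq_integral hχ hχc isOpen_ball hf hχU (hloc x hx)
    rw [(hχ1 x hx).self_of_nhds, one_smul] at h1
    rw [h1, setIntegral_eq_integral_of_forall_compl_eq_zero]
    intro z hz
    rw [hk0 x z hz, mul_zero]
  have hint : ∀ x ∈ closedBall (0 : E) (1 / 2),
      IntegrableOn (fun z => f (coordEquiv v z) * k x z) S := fun x hx =>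
    (hfS.mul (hkcont x hx).continuousOn).integrableOn_compact hSc
  have h0 : (0 : E) ∈ closedBall (0 : E) (1 / 2) := mem_closedBall_self (by norm_num)
  have hd := (hf.differentiableAt isOpen_ball (mem_ball_self one_pos)).hasFDerivAt
  refine (hd.le_of_lip' (C := |B| * V * M) (by positivity) ?_).trans (by nlinarith)
  filter_upwards [closedBall_mem_nhds (0 : E) (show (0 : ℝ) < 1 / 2 by norm_num)] with x hx
  rw [hrep x hx, hrep 0 h0, ← integral_sub (hint x hx) (hint 0 h0), sub_zero]
  refine (norm_setIntegral_le_of_norm_le_const (C := M * (|B| * ‖x‖)) hSc.measure_lt_top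
    fun z hz => ?_).trans (le_of_eq (by ring))
  rw [← mul_sub]
  exact (norm_mul_le _ _).trans (mul_le_mul (hM _ (hχU hz)) (hlip x hx z) (norm_nonneg _) hM0)

end Estimate

/-! ### Induced conditions on powers of the algebra -/

section Induced

variable {A ι κ : Type*} [NormedRing A] [NormedAlgebra ℝ A] [Fintype ι] {n : ℕ}
    {e : Module.Basis ι ℝ A} {a : κ → ι → A}

theorem sum_powBasis_inducedConditions (L : (Fin n → A) →L[ℝ] A) (l : Fin n) (m : κ) :
    ∑ s, L (powBasis n e s) * inducedConditions n a (l, m) s =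
      ∑ j, L (Pi.single l (e j)) * a m j := by
  rw [Fintype.sum_sigma, Finset.sum_eq_single l]
  · simp [powBasis, inducedConditions]
  · intro l' _ hl'
    simp [inducedConditions, hl']
  · simp

theorem isCauchyOn_powBasis_iff {f : (Fin n → A) → A} {U : Set (Fin n → A)} :
    IsCauchyOn (powBasis n e) (inducedConditions n a) f U ↔ ContDiffOn ℝ 1 f U ∧
      ∀ x ∈ U, ∀ l m, ∑ j, fderiv ℝ f x (Pi.single l (e j)) * a m j = 0 := by
  simp only [IsCauchyOn, Prod.forall, sum_powBasis_inducedConditions]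

/-- The one-variable estimate bounds the derivative along each factor, and a vector is the sum of
its `n` components, each of norm at most its sup norm. The factor `n + 1` keeps the constant
positive for `n = 0`. -/
theorem HasCauchyEstimate.powBasis (h : HasCauchyEstimate e a) (n : ℕ) :
    HasCauchyEstimate (powBasis n e) (inducedConditions n a) := by
  obtain ⟨C, hC, hest⟩ := h
  refine ⟨(n + 1) * C, by positivity, fun f x r M hr hf hM => ?_⟩
  have hM0 : 0 ≤ M := (norm_nonneg _).trans (hM x (mem_ball_self hr))
  obtain ⟨hf1, hf2⟩ := isCauchyOn_powBasis_iff.1 hf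
  have hslice : ∀ l, ‖(fderiv ℝ f x).comp (ContinuousLinearMap.single ℝ (fun _ : Fin n => A) l)‖
      ≤ C / r * M := by
    intro l
    set s := ContinuousLinearMap.single ℝ (fun _ : Fin n => A) l with hs
    have hmem : ∀ y ∈ ball (0 : A) r, x + s y ∈ ball x r := fun y hy => by
      rw [mem_ball, dist_self_add_left]
      simpa [hs, Pi.norm_single] using hy
    have h1 := hest (fun y => f (x + s y)) 0 r M hr
      ((isCauchyOn_slice isOpen_ball hf1 s (fun x hx m => hf2 x hx l m) x).mono hmem)
      fun y hy => hM _ (hmem y hy)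
    have h2 : HasFDerivAt (fun y => x + s y) s 0 := s.hasFDerivAt.const_add x
    have h3 : HasFDerivAt f (fderiv ℝ f x) (x + s 0) := by
      rw [map_zero, add_zero]
      exact (hf.differentiableAt isOpen_ball (mem_ball_self hr)).hasFDerivAt
    have h4 := (h3.comp (0 : A) h2).fderiv
    simp only [Function.comp_def] at h4
    rwa [h4] at h1
  refine ContinuousLinearMap.opNorm_le_bound _ (by positivity) fun w => ?_
  have hw : fderiv ℝ f x w = ∑ l, (fderiv ℝ f x).comp
      (ContinuousLinearMap.single ℝ (fun _ : Fin n => A) l) (w l) := by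
    conv_lhs => rw [← Finset.univ_sum_single w, map_sum]
    rfl
  rw [hw]
  calc _ ≤ ∑ l : Fin n, C / r * M * ‖w‖ := by
        refine (norm_sum_le _ _).trans (Finset.sum_le_sum fun l _ => ?_)
        refine (ContinuousLinearMap.le_opNorm _ _).trans ?_
        gcongr
        · exact hslice l
        · exact norm_le_pi_norm w l
    _ = n * (C / r * M * ‖w‖) := by simp
    _ ≤ (n + 1) * C / r * M * ‖w‖ := by
        have : 0 ≤ C / r * M * ‖w‖ := by positivity
        calc _ ≤ (n + 1) * (C / r * M * ‖w‖) := by nlinarith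
          _ = _ := by ring

end Induced

/-! ### Slices and their plateau functions -/

/-- A splitting of `E'` into slices which are copies of `E`. -/
structure Slicing (E E' : Type*) [NormedAddCommGroup E] [NormedSpace ℝ E]
    [NormedAddCommGroup E'] [NormedSpace ℝ E'] where
  incl : E →L[ℝ] E'
  proj : E' →L[ℝ] E
  proj_incl : ∀ y, proj (incl y) = y

namespace Slicing

variable {E E' : Type*} [NormedAddCommGroup E] [NormedSpace ℝ E]
    [NormedAddCommGroup E'] [NormedSpace ℝ E'] (σ : Slicing E E')

/-- The point with coordinate `y` on the slice through `x`. -/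
def pt (x : E') (y : E) : E' := x + σ.incl (y - σ.proj x)

theorem pt_proj (x : E') : σ.pt x (σ.proj x) = x := by simp [pt]

theorem proj_pt (x : E') (y : E) : σ.proj (σ.pt x y) = y := by simp [pt, σ.proj_incl]

theorem pt_add_smul {w : E'} (hw : σ.proj w = 0) (x : E') (t : ℝ) (y : E) :
    σ.pt (x + t • w) y = σ.pt x y + t • w := by
  simp [pt, hw, add_right_comm]

theorem pt_add_incl (x : E') (u y : E) : σ.pt (x + σ.incl u) y = σ.pt x y := by
  simp only [pt, map_add, σ.proj_incl, map_sub]; abel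

theorem contDiff_pt {n : ℕ∞ω} : ContDiff ℝ n fun p : E' × E => σ.pt p.1 p.2 := by
  unfold pt; fun_prop

theorem continuous_pt : Continuous fun p : E' × E => σ.pt p.1 p.2 :=
  (σ.contDiff_pt (n := 0)).continuous

/-- Plateau functions on the slice through `x`, for the pair `K ⊆ Ω`, equal to `b` near `x`. -/
structure IsPlateau (K Ω : Set E') (b : ℝ) (x : E') (χ : E → ℝ) : Prop where
  contDiff : ContDiff ℝ ∞ χ
  hasCompactSupport : HasCompactSupport χ
  pt_mem : ∀ y ∈ tsupport χ, σ.pt x y ∈ Ω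
  eq_one : ∀ y, σ.pt x y ∈ K → χ =ᶠ[𝓝 y] fun _ => 1
  eq_const : χ =ᶠ[𝓝 (σ.proj x)] fun _ => b

variable {σ} {K Ω : Set E'} {b b' : ℝ} {x : E'} {χ χ' : E → ℝ}

namespace IsPlateau

theorem fderiv_eq_zero (h : σ.IsPlateau K Ω b x χ) : ∀ᶠ y in 𝓝 (σ.proj x), fderiv ℝ χ y = 0 := by
  filter_upwards [eventually_eventually_nhds.2 h.eq_const] with y hy
  have : χ =ᶠ[𝓝 y] fun _ => b := hy
  rw [this.fderiv_eq]; simp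

/-- This is why the slice integrals only see `f` where it is given. -/
theorem pt_mem_diff (h : σ.IsPlateau K Ω b x χ) {y : E} (hy : y ∈ tsupport (fderiv ℝ χ)) :
    σ.pt x y ∈ Ω \ K := by
  refine ⟨h.pt_mem y (tsupport_fderiv_subset ℝ hy), fun hK => ?_⟩
  have : fderiv ℝ χ =ᶠ[𝓝 y] fun _ => 0 := by
    filter_upwards [eventually_eventually_nhds.2 (h.eq_one y hK)] with z hz
    have : χ =ᶠ[𝓝 z] fun _ => 1 := hz
    rw [this.fderiv_eq]; simp
  exact (notMem_tsupport_iff_eventuallyEq.2 this) hy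

/-- One `χ` serves all nearby slices, so the extension is locally an integral with a fixed plateau
function and inherits its regularity. -/
theorem eventually (hΩ : IsOpen Ω) (hK : IsCompact K) (h : σ.IsPlateau K Ω b x χ) :
    ∀ᶠ x' in 𝓝 x, σ.IsPlateau K Ω b x' χ := by
  have h1 : ∀ᶠ x' in 𝓝 x, ∀ y ∈ tsupport χ, σ.pt x' y ∈ Ω :=
    h.hasCompactSupport.eventually_forall_of_forall_eventually fun y hy =>
      σ.continuous_pt.continuousAt.preimage_mem_nhds (hΩ.mem_nhds (h.pt_mem y hy))
  have hO : IsOpen {y | χ =ᶠ[𝓝 y] fun _ => 1} := isOpen_iff_mem_nhds.2 fun y hy =>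
    eventually_eventually_nhds.2 hy
  -- A slice can meet `K` only over `σ.proj '' K`. Over the compact part of it where `χ` is not
  -- locally 1, the slice through `x` avoids `K`, and so do nearby ones.
  have h2 : ∀ᶠ x' in 𝓝 x, ∀ y ∈ σ.proj '' K \ {y | χ =ᶠ[𝓝 y] fun _ => 1}, σ.pt x' y ∈ Kᶜ :=
    ((hK.image σ.proj.continuous).diff hO).eventually_forall_of_forall_eventually fun y hy =>
      σ.continuous_pt.continuousAt.preimage_mem_nhds
        (hK.isClosed.isOpen_compl.mem_nhds fun hyK => hy.2 (h.eq_one y hyK))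
  have h3 : ∀ᶠ x' in 𝓝 x, χ =ᶠ[𝓝 (σ.proj x')] fun _ => b :=
    (σ.proj.continuous.tendsto x).eventually (eventually_eventually_nhds.2 h.eq_const)
  filter_upwards [h1, h2, h3] with x' hx1 hx2 hx3
  refine ⟨h.contDiff, h.hasCompactSupport, hx1, fun y hy => ?_, hx3⟩
  by_contra hne
  exact hx2 y ⟨⟨_, hy, σ.proj_pt x' y⟩, hne⟩ hy

theorem isOpen_setOf (hΩ : IsOpen Ω) (hK : IsCompact K) (χ : E → ℝ) :
    IsOpen {x | σ.IsPlateau K Ω b x χ} :=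
  isOpen_iff_mem_nhds.2 fun _ hx => hx.eventually hΩ hK

theorem zero_of_forall_notMem (h : ∀ y, σ.pt x y ∉ K) :
    σ.IsPlateau K Ω 0 x fun _ => 0 where
  contDiff := contDiff_const
  hasCompactSupport := HasCompactSupport.zero
  pt_mem y hy := by simp [tsupport, Function.support] at hy
  eq_one y hy := (h y hy).elim
  eq_const := EventuallyEq.rfl

end IsPlateau

theorem isCompact_slice (hK : IsCompact K) (x : E') : IsCompact {y | σ.pt x y ∈ K} := by
  refine (hK.image σ.proj.continuous).of_isClosed_subset ?_ fun y hy => ⟨_, hy, σ.proj_pt x y⟩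
  exact hK.isClosed.preimage (σ.continuous_pt.comp (Continuous.prodMk_right x))

theorem isOpen_slice (hΩ : IsOpen Ω) (x : E') : IsOpen {y | σ.pt x y ∈ Ω} :=
  hΩ.preimage (σ.continuous_pt.comp (Continuous.prodMk_right x))

theorem exists_isPlateau_one [FiniteDimensional ℝ E] (hΩ : IsOpen Ω) (hK : IsCompact K)
    (hKΩ : K ⊆ Ω) (hx : x ∈ Ω) : ∃ χ, σ.IsPlateau K Ω 1 x χ := by
  obtain ⟨χ, h1, h2, h3, h4⟩ := exists_contDiff_plateau
    ((isCompact_slice (σ := σ) hK x).insert (σ.proj x)) (isOpen_slice (σ := σ) hΩ x) (by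
      rintro y (rfl | hy)
      · simpa [σ.pt_proj] using hx
      · exact hKΩ hy)
  exact ⟨χ, h1, h2, h3, fun y hy => h4 y (mem_insert_of_mem _ hy), h4 _ (mem_insert _ _)⟩

theorem exists_isPlateau_zero [FiniteDimensional ℝ E] (hΩ : IsOpen Ω) (hK : IsCompact K)
    (hKΩ : K ⊆ Ω) (hx : x ∉ K) : ∃ χ, σ.IsPlateau K Ω 0 x χ := by
  -- Removing the point `σ.proj x` from the open set forces `χ` to vanish near it.
  obtain ⟨χ, h1, h2, h3, h4⟩ := exists_contDiff_plateau (isCompact_slice (σ := σ) hK x)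
    ((isOpen_slice (σ := σ) hΩ x).sdiff (isClosed_singleton (x := σ.proj x))) (by
      refine fun y hy => ⟨hKΩ hy, ?_⟩
      rintro rfl
      rw [mem_ofPred_eq, σ.pt_proj] at hy
      exact hx hy)
  exact ⟨χ, h1, h2, fun y hy => (h3 hy).1, h4,
    notMem_tsupport_iff_eventuallyEq.1 fun hy => (h3 hy).2 rfl⟩

/-! ### Integrals over slices -/

section Extension

variable {A ι κ : Type*} [NormedRing A] [NormedAlgebra ℝ A] [Fintype ι] [Fintype κ]
    {v : Module.Basis ι ℝ E} {a : κ → ι → A} {φ : κ → E → E → A} {f : E' → A}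

/-- The integral of `f` over a slice against the kernel of a plateau function. -/
noncomputable def integral (σ : Slicing E E') (v : Module.Basis ι ℝ E) (a : κ → ι → A)
    (φ : κ → E → E → A) (f : E' → A) (χ : E → ℝ) (x : E') : A :=
  ∫ z : EuclideanSpace ℝ ι, f (σ.pt x (coordEquiv v z)) *
    plateauKernel v a φ χ (σ.proj x) (coordEquiv v z)

/-- On the support of `dχ` both factors are `C¹`: `f` is evaluated in `Ω \ K`, and the kernel is
regular. Off that support the product vanishes locally. -/
theorem contDiffAt_integrand (hφ : IsCauchyKernel v a φ) (hU : IsOpen (Ω \ K))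
    (hf : ContDiffOn ℝ 1 f (Ω \ K)) (h : σ.IsPlateau K Ω b x χ) (z : EuclideanSpace ℝ ι) :
    ContDiffAt ℝ 1 (fun q : E' × EuclideanSpace ℝ ι => f (σ.pt q.1 (coordEquiv v q.2)) *
      plateauKernel v a φ χ (σ.proj q.1) (coordEquiv v q.2)) (x, z) := by
  have hT : ContDiffAt ℝ 1 (fun q : E' × EuclideanSpace ℝ ι => coordEquiv v q.2) (x, z) :=
    (coordEquiv v).contDiff.contDiffAt.comp (x, z) contDiffAt_snd
  by_cases hz : coordEquiv v z ∈ tsupport (fderiv ℝ χ)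
  · refine ContDiffAt.mul ?_ ?_
    · have h1 : ContDiffAt ℝ 1 f (σ.pt x (coordEquiv v z)) :=
        hf.contDiffAt (hU.mem_nhds (h.pt_mem_diff hz))
      exact h1.comp (f := fun q : E' × EuclideanSpace ℝ ι => σ.pt q.1 (coordEquiv v q.2)) (x, z)
        (σ.contDiff_pt.contDiffAt.comp (x, z) (contDiffAt_fst.prodMk hT))
    · exact (hφ.contDiffAt_plateauKernel h.contDiff h.fderiv_eq_zero (coordEquiv v z)).comp
        (f := fun q : E' × EuclideanSpace ℝ ι => (σ.proj q.1, coordEquiv v q.2)) (x, z)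
        ((σ.proj.contDiff.contDiffAt.comp (x, z) contDiffAt_fst).prodMk hT)
  · have hc : Continuous fun q : E' × EuclideanSpace ℝ ι => coordEquiv v q.2 := by fun_prop
    have : (fun q : E' × EuclideanSpace ℝ ι => f (σ.pt q.1 (coordEquiv v q.2)) *
      plateauKernel v a φ χ (σ.proj q.1) (coordEquiv v q.2)) =ᶠ[𝓝 (x, z)] fun _ => 0 := by
      filter_upwards [hc.continuousAt.preimage_mem_nhds
        ((isClosed_tsupport _).isOpen_compl.mem_nhds hz)] with q hq
      rw [plateauKernel_eq_zero_of_notMem hq, mul_zero]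
    exact contDiffAt_const.congr_of_eventuallyEq this

theorem integrand_eq_zero (x' : E') {z : EuclideanSpace ℝ ι}
    (hz : z ∉ coordEquiv v ⁻¹' tsupport (fderiv ℝ χ)) :
    f (σ.pt x' (coordEquiv v z)) * plateauKernel v a φ χ (σ.proj x') (coordEquiv v z) = 0 := by
  rw [plateauKernel_eq_zero_of_notMem hz, mul_zero]

theorem isCompact_coordEquiv_preimage_tsupport_fderiv (h : σ.IsPlateau K Ω b x χ) :
    IsCompact (coordEquiv v ⁻¹' tsupport (fderiv ℝ χ)) :=
  isCompact_coordEquiv_preimage (h.hasCompactSupport.fderiv ℝ)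

theorem integrable_integrand (hφ : IsCauchyKernel v a φ) (hU : IsOpen (Ω \ K))
    (hf : ContDiffOn ℝ 1 f (Ω \ K)) (h : σ.IsPlateau K Ω b x χ) :
    Integrable fun z : EuclideanSpace ℝ ι => f (σ.pt x (coordEquiv v z)) *
      plateauKernel v a φ χ (σ.proj x) (coordEquiv v z) := by
  refine Continuous.integrable_of_hasCompactSupport (continuous_iff_continuousAt.2 fun z => ?_)
    (HasCompactSupport.intro (isCompact_coordEquiv_preimage_tsupport_fderiv h)
      fun z hz => integrand_eq_zero x hz)
  exact (contDiffAt_integrand hφ hU hf h z).continuousAt.comp (f := fun z => (x, z)) (by fun_prop)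

theorem contDiffOn_integral (hΩ : IsOpen Ω) (hK : IsCompact K) (hφ : IsCauchyKernel v a φ)
    (hf : ContDiffOn ℝ 1 f (Ω \ K)) (h : σ.IsPlateau K Ω b x χ) :
    ContDiffOn ℝ 1 (σ.integral v a φ f χ) {x | σ.IsPlateau K Ω b x χ} :=
  contDiffOn_integral_of_isCompact (g := fun x z => f (σ.pt x (coordEquiv v z)) *
      plateauKernel v a φ χ (σ.proj x) (coordEquiv v z))
    (IsPlateau.isOpen_setOf hΩ hK χ)
    (isCompact_coordEquiv_preimage_tsupport_fderiv h)
    (fun _ _ _ hz => integrand_eq_zero _ hz)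
    fun _ hp z => contDiffAt_integrand hφ (hΩ.sdiff hK.isClosed) hf hp z

/-- Derivatives of a slice integral along the slice fall on the kernel. -/
theorem fderiv_integral_incl (hΩ : IsOpen Ω) (hK : IsCompact K) (hφ : IsCauchyKernel v a φ)
    (hf : ContDiffOn ℝ 1 f (Ω \ K)) (h : σ.IsPlateau K Ω b x χ) (u : E) :
    fderiv ℝ (σ.integral v a φ f χ) x (σ.incl u) =
      ∫ z : EuclideanSpace ℝ ι, f (σ.pt x (coordEquiv v z)) *
        fderiv ℝ (fun y => plateauKernel v a φ χ y (coordEquiv v z)) (σ.proj x) u := by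
  have hU := hΩ.sdiff hK.isClosed
  obtain ⟨L, hL, hLw⟩ := hasFDerivAt_integral_of_isCompact (μ := volume)
    (g := fun x z => f (σ.pt x (coordEquiv v z)) *
      plateauKernel v a φ χ (σ.proj x) (coordEquiv v z))
    (IsPlateau.isOpen_setOf hΩ hK χ) (isCompact_coordEquiv_preimage_tsupport_fderiv h)
    (fun _ _ _ hz => integrand_eq_zero _ hz)
    (fun _ hp z => contDiffAt_integrand hφ hU hf hp z) h
  have hL' : HasFDerivAt (σ.integral v a φ f χ) L x := hL
  rw [hL'.fderiv, hLw]
  refine integral_congr_ae (Eventually.of_forall fun z => ?_)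
  have h1 : DifferentiableAt ℝ (fun x => f (σ.pt x (coordEquiv v z)) *
      plateauKernel v a φ χ (σ.proj x) (coordEquiv v z)) x :=
    ((contDiffAt_integrand hφ hU hf h z).differentiableAt one_ne_zero).comp
      (f := fun x => (x, z)) x (by fun_prop)
  have h2 : DifferentiableAt ℝ (fun y => plateauKernel v a φ χ y (coordEquiv v z)) (σ.proj x) :=
    ((hφ.contDiffAt_plateauKernel h.contDiff h.fderiv_eq_zero
      (coordEquiv v z)).differentiableAt one_ne_zero).comp
      (f := fun y => (y, coordEquiv v z)) (σ.proj x) (by fun_prop)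
  simp only
  -- Moving `x` by `σ.incl u` does not change `σ.pt x y`, so along this line the factor `f` is
  -- constant.
  rw [← h1.lineDeriv_eq_fderiv, ← h2.lineDeriv_eq_fderiv]
  simp only [lineDeriv, ← map_smul, σ.pt_add_incl, map_add, σ.proj_incl]
  refine deriv_const_mul _ ?_
  have h3 : DifferentiableAt ℝ (fun y => plateauKernel v a φ χ y (coordEquiv v z))
      (σ.proj x + (0 : ℝ) • u) := by simpa using h2
  exact h3.comp (f := fun t : ℝ => σ.proj x + t • u) (0 : ℝ) (by fun_prop)

/-- Two plateau functions give integrals that differ by a multiple of `f`. -/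
theorem integral_sub_integral [FiniteDimensional ℝ E] [CompleteSpace A]
    (hΩ : IsOpen Ω) (hK : IsCompact K) (hφ : IsCauchyKernel v a φ)
    (hf : ContDiffOn ℝ 1 f (Ω \ K))
    (hs : ∀ x ∈ Ω \ K, ∀ m, ∑ j, fderiv ℝ f x (σ.incl (v j)) * a m j = 0)
    (h : σ.IsPlateau K Ω b x χ) (h' : σ.IsPlateau K Ω b' x χ') :
    σ.integral v a φ f χ x - σ.integral v a φ f χ' x = (b - b') • f x := by
  have hU := hΩ.sdiff hK.isClosed
  have hslice : IsCauchyOn v a (fun y => f (σ.pt x y)) {y | σ.pt x y ∈ Ω \ K} := by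
    have hpt : ∀ y, σ.pt x y = x - σ.incl (σ.proj x) + σ.incl y := fun y => by
      simp only [pt, map_sub]; abel
    simp only [hpt]
    exact isCauchyOn_slice hU hf σ.incl hs _
  have hχ1 := h.contDiff.differentiable (by simp)
  have hχ1' := h'.contDiff.differentiable (by simp)
  have hd : ∀ y, fderiv ℝ (fun y => χ y - χ' y) y = fderiv ℝ χ y - fderiv ℝ χ' y := fun y =>
    fderiv_fun_sub (hχ1 y) (hχ1' y)
  -- Both plateau functions equal 1 near `K`, so their difference is supported where `f` is Cauchy
  -- on the slice and the reproducing formula applies.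
  have hsupp : tsupport (fun y => χ y - χ' y) ⊆ {y | σ.pt x y ∈ Ω \ K} := by
    intro y hy
    refine ⟨?_, fun hyK => ?_⟩
    · rcases tsupport_sub χ χ' hy with h0 | h0
      · exact h.pt_mem y h0
      · exact h'.pt_mem y h0
    · refine notMem_tsupport_iff_eventuallyEq.2 ?_ hy
      filter_upwards [h.eq_one y hyK, h'.eq_one y hyK] with z hz hz'
      simp [hz, hz']
  have key := hφ.smul_eq_integral (h.contDiff.sub h'.contDiff)
    (h.hasCompactSupport.sub h'.hasCompactSupport) (isOpen_slice (σ := σ) hU x) hslice hsupp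
    (x := σ.proj x) (by
      filter_upwards [h.fderiv_eq_zero, h'.fderiv_eq_zero] with y hy hy'
      exact (hd y).trans (by rw [hy, hy', sub_zero]))
  rw [σ.pt_proj, h.eq_const.self_of_nhds, h'.eq_const.self_of_nhds] at key
  rw [key, integral, integral, ← integral_sub (integrable_integrand hφ hU hf h)
    (integrable_integrand hφ hU hf h')]
  refine integral_congr_ae (Eventually.of_forall fun z => ?_)
  simp only [← mul_sub]
  congr 1
  simp only [plateauKernel]
  rw [show fderiv ℝ (fun y => χ y - χ' y) (coordEquiv v z) = _ from hd _]
  simp only [sub_apply, sub_smul, Finset.sum_sub_distrib, smul_sub]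
  abel

end Extension

end Slicing

/-! ### Analytic continuation along lines -/

theorem eq_zero_of_analytic_of_eventually_atTop {F : Type*} [NormedAddCommGroup F]
    [NormedSpace ℝ F] {h : ℝ → F} (ha : ∀ t, AnalyticAt ℝ h t) (h0 : ∀ᶠ t in atTop, h t = 0)
    (t : ℝ) : h t = 0 := by
  obtain ⟨T, hT⟩ := eventually_atTop.1 h0
  refine AnalyticOnNhd.eqOn_zero_of_preconnected_of_eventuallyEq_zero (𝕜 := ℝ) (f := h)
    (U := univ) (fun t _ => ha t) isPreconnected_univ (mem_univ (T + 1)) ?_ (mem_univ t)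
  filter_upwards [lt_mem_nhds (show T < T + 1 by linarith)] with s hs using hT s hs.le

theorem analyticAt_line_of_zero {E' F : Type*} [NormedAddCommGroup E'] [NormedSpace ℝ E']
    [NormedAddCommGroup F] [NormedSpace ℝ F] {h : E' → F} {x w : E'} {t : ℝ}
    (ha : AnalyticAt ℝ (fun s : ℝ => h (x + t • w + s • w)) 0) :
    AnalyticAt ℝ (fun s : ℝ => h (x + s • w)) t := by
  have h1 : AnalyticAt ℝ (fun s : ℝ => s - t) t := by fun_prop
  rw [← sub_self t] at ha
  refine (ha.fun_comp (f := fun s : ℝ => s - t) h1).congr (Eventually.of_forall fun s => ?_)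
  simp only
  rw [add_assoc, ← add_smul, add_sub_cancel]

theorem tendsto_add_smul_nhds_zero {E' : Type*} [NormedAddCommGroup E'] [NormedSpace ℝ E']
    (x w : E') : Tendsto (fun t : ℝ => x + t • w) (𝓝 0) (𝓝 x) := by
  have : Continuous fun t : ℝ => x + t • w := by fun_prop
  simpa using this.tendsto 0

/-- Two functions on `Ω` and on the complement of `K` which agree on `Ω \ K`, are analytic on lines
of direction `w` and vanish far away on them, are zero. -/
theorem eq_zero_of_analytic_lines {E' F : Type*} [NormedAddCommGroup E'] [NormedSpace ℝ E']
    [NormedAddCommGroup F] [NormedSpace ℝ F] {K Ω : Set E'} (hΩ : IsOpen Ω) (hK : IsClosed K)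
    (hKΩ : K ⊆ Ω) {h₁ h₀ : E' → F} (heq : EqOn h₁ h₀ (Ω \ K)) {w : E'}
    (h1 : ∀ x ∈ Ω, AnalyticAt ℝ (fun t : ℝ => h₁ (x + t • w)) 0)
    (h0 : ∀ x ∉ K, AnalyticAt ℝ (fun t : ℝ => h₀ (x + t • w)) 0)
    (hfar : ∀ x, ∀ᶠ t : ℝ in atTop, x + t • w ∉ K ∧ h₀ (x + t • w) = 0) :
    (∀ x ∈ Ω, h₁ x = 0) ∧ ∀ x ∉ K, h₀ x = 0 := by
  classical
  -- Since `K ⊆ Ω`, every point is in `Ω` or off `K`, and agreement on the overlap makes the glued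
  -- function analytic on every line of direction `w`.
  set h : E' → F := fun x => if x ∈ Ω then h₁ x else h₀ x with hdef
  have e1 : ∀ x ∈ Ω, h x = h₁ x := fun x hx => if_pos hx
  have e0 : ∀ x ∉ K, h x = h₀ x := fun x hx => by
    by_cases hxΩ : x ∈ Ω
    · rw [e1 x hxΩ, heq ⟨hxΩ, hx⟩]
    · exact if_neg hxΩ
  have han : ∀ x, AnalyticAt ℝ (fun t : ℝ => h (x + t • w)) 0 := by
    intro x
    by_cases hx : x ∈ Ω
    · refine (h1 x hx).congr ?_
      filter_upwards [(tendsto_add_smul_nhds_zero x w).eventually (hΩ.mem_nhds hx)] with t ht using (e1 _ ht).symm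
    · have hx' : x ∉ K := fun hk => hx (hKΩ hk)
      refine (h0 x hx').congr ?_
      filter_upwards [(tendsto_add_smul_nhds_zero x w).eventually (hK.isOpen_compl.mem_nhds hx')] with t ht
        using (e0 _ ht).symm
  have hz : ∀ x, h x = 0 := fun x => by
    have := eq_zero_of_analytic_of_eventually_atTop
      (fun t => analyticAt_line_of_zero (han (x + t • w)))
      ((hfar x).mono fun t ht => (e0 _ ht.1).trans ht.2) 0
    simpa using this
  exact ⟨fun x hx => (e1 x hx).symm.trans (hz x), fun x hx => (e0 x hx).symm.trans (hz x)⟩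

/-! ### The interior and exterior parts of f and their Cauchy conditions -/

namespace Slicing

variable {E E' : Type*} [NormedAddCommGroup E] [NormedSpace ℝ E]
    [NormedAddCommGroup E'] [NormedSpace ℝ E'] {σ : Slicing E E'}
    {K Ω : Set E'} {b b' : ℝ} {x : E'} {χ χ' : E → ℝ}
    {A ι κ : Type*} [NormedRing A] [NormedAlgebra ℝ A] [Fintype ι] [Fintype κ]
    {v : Module.Basis ι ℝ E} {a : κ → ι → A} {φ : κ → E → E → A} {f : E' → A}

open Classical in
/-- The slice integral for any choice of plateau functions equal to `b` near the point. For `b = 1`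
it is the extension of `f` to `Ω`, for `b = 0` it is the part of `f` regular outside `K`. -/
noncomputable def ext (σ : Slicing E E') (v : Module.Basis ι ℝ E) (a : κ → ι → A)
    (φ : κ → E → E → A) (f : E' → A) (K Ω : Set E') (b : ℝ) (x : E') : A :=
  if h : ∃ χ, σ.IsPlateau K Ω b x χ then σ.integral v a φ f h.choose x else 0

/-- The hypotheses under which the extension is studied. -/
structure ExtData (σ : Slicing E E') (v : Module.Basis ι ℝ E) (a : κ → ι → A)
    (φ : κ → E → E → A) (f : E' → A) (K Ω : Set E') : Prop where
  isOpen : IsOpen Ω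
  isCompact : IsCompact K
  subset : K ⊆ Ω
  kernel : IsCauchyKernel v a φ
  contDiffOn : ContDiffOn ℝ 1 f (Ω \ K)
  slice : ∀ x ∈ Ω \ K, ∀ m, ∑ j, fderiv ℝ f x (σ.incl (v j)) * a m j = 0

namespace ExtData

theorem isOpen_diff (d : σ.ExtData v a φ f K Ω) : IsOpen (Ω \ K) :=
  d.isOpen.sdiff d.isCompact.isClosed

/-- On a slice missing `K` the plateau function 0 is allowed, and the value does not depend on the
choice. -/
theorem ext_zero_of_forall_notMem (h : ∀ y, σ.pt x y ∉ K) [FiniteDimensional ℝ E] [CompleteSpace A]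
    (d : σ.ExtData v a φ f K Ω) : σ.ext v a φ f K Ω 0 x = 0 := by
  have h0 := IsPlateau.zero_of_forall_notMem (σ := σ) (Ω := Ω) h
  have hex : ∃ χ, σ.IsPlateau K Ω 0 x χ := ⟨_, h0⟩
  have h1 := integral_sub_integral d.isOpen d.isCompact d.kernel d.contDiffOn d.slice
    hex.choose_spec h0
  have h2 : σ.integral v a φ f (fun _ => 0) x = 0 := by
    simp [Slicing.integral, plateauKernel]
  rw [h2, sub_zero, sub_zero, zero_smul] at h1
  rw [ext, dif_pos hex, h1]

variable [FiniteDimensional ℝ E] [CompleteSpace A]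

theorem ext_eq (d : σ.ExtData v a φ f K Ω) (h : σ.IsPlateau K Ω b x χ) :
    σ.ext v a φ f K Ω b x = σ.integral v a φ f χ x := by
  have hex : ∃ χ, σ.IsPlateau K Ω b x χ := ⟨_, h⟩
  rw [ext, dif_pos hex, ← sub_eq_zero, integral_sub_integral d.isOpen d.isCompact d.kernel
    d.contDiffOn d.slice hex.choose_spec h, sub_self, zero_smul]

theorem ext_eventuallyEq (d : σ.ExtData v a φ f K Ω) (h : σ.IsPlateau K Ω b x χ) :
    σ.ext v a φ f K Ω b =ᶠ[𝓝 x] σ.integral v a φ f χ :=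
  (h.eventually d.isOpen d.isCompact).mono fun _ hx => d.ext_eq hx

theorem contDiffAt_ext (d : σ.ExtData v a φ f K Ω) (h : σ.IsPlateau K Ω b x χ) :
    ContDiffAt ℝ 1 (σ.ext v a φ f K Ω b) x :=
  ((contDiffOn_integral d.isOpen d.isCompact d.kernel d.contDiffOn h).contDiffAt
    ((IsPlateau.isOpen_setOf d.isOpen d.isCompact χ).mem_nhds h)).congr_of_eventuallyEq
    (d.ext_eventuallyEq h)

theorem contDiffOn_ext_one (d : σ.ExtData v a φ f K Ω) :
    ContDiffOn ℝ 1 (σ.ext v a φ f K Ω 1) Ω := fun _ hx =>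
  (d.contDiffAt_ext (exists_isPlateau_one d.isOpen d.isCompact d.subset
    hx).choose_spec).contDiffWithinAt

theorem contDiffOn_ext_zero (d : σ.ExtData v a φ f K Ω) :
    ContDiffOn ℝ 1 (σ.ext v a φ f K Ω 0) Kᶜ := fun _ hx =>
  (d.contDiffAt_ext (exists_isPlateau_zero d.isOpen d.isCompact d.subset
    hx).choose_spec).contDiffWithinAt

/-- The additive splitting of `f` into a part regular on `Ω` and a part regular off `K`: the two
plateau constants at `x` differ by 1. -/
theorem ext_sub_ext (d : σ.ExtData v a φ f K Ω) (hx : x ∈ Ω \ K) :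
    σ.ext v a φ f K Ω 1 x - σ.ext v a φ f K Ω 0 x = f x := by
  obtain ⟨χ, h⟩ := exists_isPlateau_one (σ := σ) d.isOpen d.isCompact d.subset hx.1
  obtain ⟨χ', h'⟩ := exists_isPlateau_zero (σ := σ) d.isOpen d.isCompact d.subset hx.2
  rw [d.ext_eq h, d.ext_eq h', integral_sub_integral d.isOpen d.isCompact d.kernel
    d.contDiffOn d.slice h h', sub_zero, one_smul]

theorem fderiv_ext_sub (d : σ.ExtData v a φ f K Ω) (hx : x ∈ Ω \ K) :
    fderiv ℝ (σ.ext v a φ f K Ω 1) x - fderiv ℝ (σ.ext v a φ f K Ω 0) x = fderiv ℝ f x := by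
  have h1 := (d.contDiffOn_ext_one.contDiffAt (d.isOpen.mem_nhds hx.1)).differentiableAt one_ne_zero
  have h0 := (d.contDiffOn_ext_zero.contDiffAt
    (d.isCompact.isClosed.isOpen_compl.mem_nhds hx.2)).differentiableAt one_ne_zero
  rw [← fderiv_fun_sub h1 h0]
  refine EventuallyEq.fderiv_eq ?_
  filter_upwards [d.isOpen_diff.mem_nhds hx] with y hy using d.ext_sub_ext hy

section Analytic

variable [FiniteDimensional ℝ E'] {ι' κ' : Type*} [Fintype ι'] {v' : Module.Basis ι' ℝ E'}
  {a' : κ' → ι' → A} {w : E'}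

/-- As `σ.proj w = 0`, moving `x` along `w` leaves `χ` and the kernel unchanged and only translates
the argument of `f`. -/
theorem analyticAt_ext_line (d : σ.ExtData v a φ f K Ω) (hest : HasCauchyEstimate v' a')
    (hf : IsCauchyOn v' a' f (Ω \ K)) (hw : σ.proj w = 0) (h : σ.IsPlateau K Ω b x χ) :
    AnalyticAt ℝ (fun t : ℝ => σ.ext v a φ f K Ω b (x + t • w)) 0 := by
  have hint := hf.analyticAt_integral_line hest d.isOpen_diff w (μ := volume)
    (isCompact_coordEquiv_preimage_tsupport_fderiv (v := v) h)
    (q := fun z => σ.pt x (coordEquiv v z))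
    (σ.continuous_pt.comp (Continuous.prodMk continuous_const
      (coordEquiv v).continuous)).continuousOn
    (fun z hz => h.pt_mem_diff hz)
    (k := fun z => plateauKernel v a φ χ (σ.proj x) (coordEquiv v z))
    (fun z _ => ((d.kernel.contDiffAt_plateauKernel h.contDiff h.fderiv_eq_zero
      (coordEquiv v z)).continuousAt.comp (f := fun z => (σ.proj x, coordEquiv v z))
      (by fun_prop)).continuousWithinAt)
    (fun z hz => plateauKernel_eq_zero_of_notMem hz)
  refine hint.congr ?_
  filter_upwards [(tendsto_add_smul_nhds_zero x w).eventually (d.ext_eventuallyEq h)] with t ht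
  rw [ht]
  simp [Slicing.integral, σ.pt_add_smul hw, hw]

/-- A derivative along the slice only replaces the kernel by its derivative in `x`, which is still
continuous in `z` and unaffected by motion along `w`. -/
theorem analyticAt_fderiv_ext_line (d : σ.ExtData v a φ f K Ω) (hest : HasCauchyEstimate v' a')
    (hf : IsCauchyOn v' a' f (Ω \ K)) (hw : σ.proj w = 0) (h : σ.IsPlateau K Ω b x χ) (u : E) :
    AnalyticAt ℝ (fun t : ℝ => fderiv ℝ (σ.ext v a φ f K Ω b) (x + t • w) (σ.incl u)) 0 := by
  have hk : ∀ z, ContDiffAt ℝ 1 (fun p : E × E => plateauKernel v a φ χ p.1 p.2)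
      (σ.proj x, coordEquiv v z) := fun z =>
    d.kernel.contDiffAt_plateauKernel h.contDiff h.fderiv_eq_zero (coordEquiv v z)
  have hk' : ∀ z, fderiv ℝ (fun y => plateauKernel v a φ χ y (coordEquiv v z)) (σ.proj x) u =
      fderiv ℝ (fun p : E × E => plateauKernel v a φ χ p.1 p.2) (σ.proj x, coordEquiv v z)
        (u, 0) := by
    intro z
    have h1 := (((hk z).differentiableAt one_ne_zero).hasFDerivAt.comp
      (f := fun y : E => (y, coordEquiv v z)) (σ.proj x) (hasFDerivAt_prodMk_left _ _)).fderiv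
    simp only [Function.comp_def] at h1
    rw [h1]; simp
  have hint := hf.analyticAt_integral_line hest d.isOpen_diff w (μ := volume)
    (isCompact_coordEquiv_preimage_tsupport_fderiv (v := v) h)
    (q := fun z => σ.pt x (coordEquiv v z))
    (σ.continuous_pt.comp (Continuous.prodMk continuous_const
      (coordEquiv v).continuous)).continuousOn
    (fun z hz => h.pt_mem_diff hz)
    (k := fun z => fderiv ℝ (fun y => plateauKernel v a φ χ y (coordEquiv v z)) (σ.proj x) u)
    (fun z _ => by
      simp only [hk']
      refine ContinuousAt.continuousWithinAt ?_
      have h1 := ((hk z).continuousAt_fderiv one_ne_zero).comp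
        (f := fun z => (σ.proj x, coordEquiv v z)) (by fun_prop)
      exact h1.clm_apply continuousAt_const)
    (fun z hz => by
      have : (fun y => plateauKernel v a φ χ y (coordEquiv v z)) = fun _ => 0 :=
        funext fun y => plateauKernel_eq_zero_of_notMem hz
      rw [this]; simp)
  refine hint.congr ?_
  filter_upwards [(tendsto_add_smul_nhds_zero x w).eventually (eventually_eventually_nhds.2
    (d.ext_eventuallyEq h)), (tendsto_add_smul_nhds_zero x w).eventually
    (h.eventually d.isOpen d.isCompact)] with t ht hpt
  have he : σ.ext v a φ f K Ω b =ᶠ[𝓝 (x + t • w)] σ.integral v a φ f χ := ht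
  rw [he.fderiv_eq, fderiv_integral_incl d.isOpen d.isCompact d.kernel d.contDiffOn hpt]
  simp [σ.pt_add_smul hw, hw]

/-- Both extensions satisfy the conditions `a` along the slices. -/
theorem slice_ext (d : σ.ExtData v a φ f K Ω) (hest : HasCauchyEstimate v' a')
    (hf : IsCauchyOn v' a' f (Ω \ K)) (hw : σ.proj w = 0) {l : E' →L[ℝ] ℝ}
    (hl : ∀ y, l (σ.incl y) = 0) (hlw : l w = 1) (m : κ) :
    (∀ x ∈ Ω, ∑ j, fderiv ℝ (σ.ext v a φ f K Ω 1) x (σ.incl (v j)) * a m j = 0) ∧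
      ∀ x ∉ K, ∑ j, fderiv ℝ (σ.ext v a φ f K Ω 0) x (σ.incl (v j)) * a m j = 0 := by
  obtain ⟨M, hM⟩ := d.isCompact.exists_bound_of_continuousOn l.continuous.continuousOn
  -- The functional `l` is constant on slices, so a slice at height above `M` misses `K`.
  have hzero : ∀ x, M < l x → σ.ext v a φ f K Ω 0 =ᶠ[𝓝 x] fun _ => 0 := by
    intro x hx
    filter_upwards [(isOpen_lt continuous_const l.continuous).mem_nhds hx] with y hy
    refine d.ext_zero_of_forall_notMem fun y' hy' => ?_
    have h1 := (le_abs_self _).trans (hM _ hy')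
    have h2 : l (σ.pt y y') = l y := by simp [pt, hl]
    rw [h2] at h1
    exact absurd hy (not_lt.2 h1)
  refine eq_zero_of_analytic_lines d.isOpen d.isCompact.isClosed d.subset (w := w)
    (fun x hx => ?_) (fun x hx => ?_) (fun x hx => ?_) fun x => ?_
  · have := d.slice x hx m
    rw [← d.fderiv_ext_sub hx] at this
    simpa [sub_mul, Finset.sum_sub_distrib, sub_eq_zero] using this
  · obtain ⟨χ, h⟩ := exists_isPlateau_one (σ := σ) d.isOpen d.isCompact d.subset hx
    exact Finset.analyticAt_fun_sum _ fun j _ =>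
      (d.analyticAt_fderiv_ext_line hest hf hw h (v j)).mul analyticAt_const
  · obtain ⟨χ, h⟩ := exists_isPlateau_zero (σ := σ) d.isOpen d.isCompact d.subset hx
    exact Finset.analyticAt_fun_sum _ fun j _ =>
      (d.analyticAt_fderiv_ext_line hest hf hw h (v j)).mul analyticAt_const
  · filter_upwards [eventually_gt_atTop (M - l x)] with t ht
    have hlt : M < l (x + t • w) := by
      simp only [map_add, map_smul, hlw, smul_eq_mul, mul_one]; linarith
    refine ⟨fun hK => absurd hlt (not_lt.2 ((le_abs_self _).trans (hM _ hK))), ?_⟩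
    rw [(hzero _ hlt).fderiv_eq]
    simp

/-- The exterior part vanishes over the complement of the projection of `K`. -/
theorem ext_zero_of_proj_notMem (d : σ.ExtData v a φ f K Ω) (hest : HasCauchyEstimate v' a')
    (hf : IsCauchyOn v' a' f (Ω \ K)) (hw : σ.proj w = 0) {l : E' →L[ℝ] ℝ}
    (hl : ∀ y, l (σ.incl y) = 0) (hlw : l w = 1) (hx : σ.proj x ∉ σ.proj '' K) :
    σ.ext v a φ f K Ω 0 x = 0 := by
  obtain ⟨M, hM⟩ := d.isCompact.exists_bound_of_continuousOn l.continuous.continuousOn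
  -- The projection is constant on the line, so the line never meets `K` and the exterior part is
  -- analytic on all of it.
  have han : ∀ t : ℝ, AnalyticAt ℝ (fun t : ℝ => σ.ext v a φ f K Ω 0 (x + t • w)) t := by
    intro t
    have hxt : x + t • w ∉ K := fun hK => hx ⟨_, hK, by simp [hw]⟩
    obtain ⟨χ, h⟩ := exists_isPlateau_zero (σ := σ) d.isOpen d.isCompact d.subset hxt
    exact analyticAt_line_of_zero (d.analyticAt_ext_line hest hf hw h)
  have := eq_zero_of_analytic_of_eventually_atTop han (by
    filter_upwards [eventually_gt_atTop (M - l x)] with t ht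
    refine d.ext_zero_of_forall_notMem fun y' hy' => ?_
    have h1 := (le_abs_self _).trans (hM _ hy')
    have h2 : l (σ.pt (x + t • w) y') = l x + t := by simp [pt, hl, hlw]
    rw [h2] at h1
    linarith) 0
  simpa using this

/-- Every condition satisfied by `f` is inherited by the two extensions. -/
theorem isCauchyOn_ext (d : σ.ExtData v a φ f K Ω) (hest : HasCauchyEstimate v' a')
    (hestv : HasCauchyEstimate v a)
    (hf : IsCauchyOn v' a' f (Ω \ K)) (hw : σ.proj w = 0) {l : E' →L[ℝ] ℝ}
    (hl : ∀ y, l (σ.incl y) = 0) (hlw : l w = 1) [Nontrivial E] :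
    IsCauchyOn v' a' (σ.ext v a φ f K Ω 1) Ω ∧ IsCauchyOn v' a' (σ.ext v a φ f K Ω 0) Kᶜ := by
  obtain ⟨y₁, hy₁⟩ := exists_ne (0 : E)
  have hKo : IsOpen Kᶜ := d.isCompact.isClosed.isOpen_compl
  -- Once the slices are Cauchy, derivatives in arbitrary directions `u` are Cauchy on slices too.
  -- This allows continuation along the slice, where the kernel gave no analyticity.
  have hsl : ∀ {b : ℝ} {O : Set E'}, IsOpen O → ContDiffOn ℝ 1 (σ.ext v a φ f K Ω b) O →
      (∀ x ∈ O, ∀ m, ∑ j, fderiv ℝ (σ.ext v a φ f K Ω b) x (σ.incl (v j)) * a m j = 0) →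
      ∀ x ∈ O, ∀ u : E', AnalyticAt ℝ
        (fun t : ℝ => fderiv ℝ (σ.ext v a φ f K Ω b) (x + t • σ.incl y₁) u) 0 := by
    intro b O hO hc h0 x hx u
    have h2 := IsCauchyOn.fderiv_slice hestv hO hc σ.incl (isCauchyOn_slice hO hc σ.incl h0) u x
    have h3 := h2.analyticAt_line hestv (hO.preimage (by fun_prop)) (x := 0) (w := y₁) (t := 0)
      (by simpa using hx)
    simpa using h3
  have hs := d.slice_ext hest hf hw hl hlw
  have hfar : ∀ x, ∀ᶠ t : ℝ in atTop, σ.proj (x + t • σ.incl y₁) ∉ σ.proj '' K := by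
    intro x
    obtain ⟨M, hM⟩ := d.isCompact.exists_bound_of_continuousOn σ.proj.continuous.continuousOn
    filter_upwards [eventually_gt_atTop ((M + ‖σ.proj x‖) / ‖y₁‖), eventually_gt_atTop 0]
      with t ht ht0
    rintro ⟨y, hy, hye⟩
    have h1 := hM y hy
    rw [hye, map_add, map_smul, σ.proj_incl] at h1
    rw [div_lt_iff₀ (norm_pos_iff.2 hy₁)] at ht
    have h2 := norm_sub_le (σ.proj x + t • y₁) (σ.proj x)
    rw [add_sub_cancel_left, norm_smul, Real.norm_of_nonneg ht0.le] at h2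
    linarith
  have key : ∀ m', (∀ x ∈ Ω, ∑ j, fderiv ℝ (σ.ext v a φ f K Ω 1) x (v' j) * a' m' j = 0) ∧
      ∀ x ∉ K, ∑ j, fderiv ℝ (σ.ext v a φ f K Ω 0) x (v' j) * a' m' j = 0 := by
    intro m'
    refine eq_zero_of_analytic_lines d.isOpen d.isCompact.isClosed d.subset (w := σ.incl y₁)
      (fun x hx => ?_) (fun x hx => ?_) (fun x hx => ?_) fun x => ?_
    · have := hf.2 x hx m'
      rw [← d.fderiv_ext_sub hx] at this
      simpa [sub_mul, Finset.sum_sub_distrib, sub_eq_zero] using this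
    · exact Finset.analyticAt_fun_sum _ fun j _ =>
        (hsl d.isOpen d.contDiffOn_ext_one (fun x hx m => (hs m).1 x hx) x hx _).mul
          analyticAt_const
    · exact Finset.analyticAt_fun_sum _ fun j _ =>
        (hsl hKo d.contDiffOn_ext_zero (fun x hx m => (hs m).2 x hx) x hx _).mul
          analyticAt_const
    · filter_upwards [hfar x] with t ht
      refine ⟨fun hK => ht ⟨_, hK, rfl⟩, ?_⟩
      have hopen : IsOpen {x | σ.proj x ∉ σ.proj '' K} :=
        (d.isCompact.image σ.proj.continuous).isClosed.isOpen_compl.preimage σ.proj.continuous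
      have : σ.ext v a φ f K Ω 0 =ᶠ[𝓝 (x + t • σ.incl y₁)] fun _ => 0 := by
        filter_upwards [hopen.mem_nhds ht] with y hy
          using d.ext_zero_of_proj_notMem hest hf hw hl hlw hy
      rw [this.fderiv_eq]
      simp
  exact ⟨⟨d.contDiffOn_ext_one, fun x hx m' => (key m').1 x hx⟩,
    ⟨d.contDiffOn_ext_zero, fun x hx m' => (key m').2 x hx⟩⟩

/-- Hartogs extension across a compact set. -/
theorem exists_extension (d : σ.ExtData v a φ f K Ω) (hest : HasCauchyEstimate v' a')
    (hestv : HasCauchyEstimate v a)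
    (hf : IsCauchyOn v' a' f (Ω \ K)) (hconn : IsPreconnected (Ω \ K)) (hw : σ.proj w = 0)
    {l : E' →L[ℝ] ℝ} (hl : ∀ y, l (σ.incl y) = 0) (hlw : l w = 1) [Nontrivial E] :
    ∃ F, IsCauchyOn v' a' F Ω ∧ EqOn F f (Ω \ K) := by
  obtain ⟨h1, h0⟩ := d.isCauchyOn_ext hest hestv hf hw hl hlw
  refine ⟨_, h1, ?_⟩
  suffices hz : EqOn (σ.ext v a φ f K Ω 0) 0 (Ω \ K) from fun x hx => by
    have := d.ext_sub_ext hx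
    rwa [hz hx, Pi.zero_apply, sub_zero] at this
  rcases K.eq_empty_or_nonempty with rfl | hne
  · exact fun x _ => d.ext_zero_of_forall_notMem fun y => notMem_empty _
  obtain ⟨p, hp, hmax⟩ := d.isCompact.exists_isMaxOn hne l.continuous.continuousOn
  have hout : ∀ x, l p < l x → x ∉ K ∧ σ.ext v a φ f K Ω 0 x = 0 := fun x hx => by
    refine ⟨fun hK => absurd hx (not_lt.2 (hmax hK)), d.ext_zero_of_forall_notMem fun y hy => ?_⟩
    have h2 : l (σ.pt x y) = l x := by simp [pt, hl]
    have h3 : l (σ.pt x y) ≤ l p := hmax hy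
    linarith
  -- Just beyond a point of `K` maximising `l`, a point of `Ω \ K` lies in the open half-space where
  -- the exterior part vanishes.
  obtain ⟨t, htΩ, ht⟩ : ∃ t : ℝ, p + t • w ∈ Ω ∧ 0 < t := by
    have h3 : ∀ᶠ t : ℝ in 𝓝[>] 0, p + t • w ∈ Ω :=
      nhdsWithin_le_nhds ((tendsto_add_smul_nhds_zero p w).eventually (d.isOpen.mem_nhds (d.subset hp)))
    exact (h3.and self_mem_nhdsWithin).exists
  have hlt : l p < l (p + t • w) := by simpa [hlw] using ht
  refine (h0.mono fun x hx => hx.2).eqOn_zero_of_preconnected hest d.isOpen_diff hconn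
    (z := p + t • w) ⟨htΩ, (hout _ hlt).1⟩ ?_
  filter_upwards [(isOpen_lt continuous_const l.continuous).mem_nhds hlt] with x hx
    using (hout x hx).2

end Analytic

end ExtData

end Slicing

/-! ### The Hartogs theorem for shells -/

theorem mainTheorem6 {A : Type*} [NormedRing A] [NormedAlgebra ℝ A] {k q n : ℕ} (hn : 2 ≤ n)
    (e : Module.Basis (Fin k) ℝ A) (a : Fin q → Fin k → A) (ha : AdmissibleConditions e a)
    (D : Set (Fin n → A)) (hD : IsSmoothBoundedDomain D)
    (U : Set (Fin n → A)) (hU : IsOpen U) (hUconn : IsConnected U) (hDU : frontier D ⊆ U)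
    (f : (Fin n → A) → A) (hf : IsCauchyOn (powBasis n e) (inducedConditions n a) f U) :
    ∃ F : (Fin n → A) → A,
      IsCauchyOn (powBasis n e) (inducedConditions n a) F (D ∪ U) ∧ Set.EqOn F f U := by
  rcases subsingleton_or_nontrivial A with hA | hA
  · exact ⟨f, ⟨contDiff_of_subsingleton.contDiffOn, fun x _ m => Subsingleton.elim _ _⟩,
      fun x _ => rfl⟩
  have : FiniteDimensional ℝ A := e.finiteDimensional_of_finite
  have : CompleteSpace A := FiniteDimensional.complete ℝ A
  have : ProperSpace (Fin n → A) := FiniteDimensional.proper_real _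
  obtain ⟨φ, hφ⟩ := id ha
  have hestv := ha.hasCauchyEstimate
  set i₀ : Fin n := ⟨0, by omega⟩
  set i₁ : Fin n := ⟨1, by omega⟩
  have hne : i₀ ≠ i₁ := by simp [i₀, i₁]
  let σ : Slicing A (Fin n → A) :=
    ⟨ContinuousLinearMap.single ℝ (fun _ => A) i₀, ContinuousLinearMap.proj i₀, fun y => by simp⟩
  -- Composed with the second coordinate, `l₀` vanishes on the slices and is 1 on the transverse
  -- direction `Pi.single i₁ 1`. It needs `1 ≠ 0`, hence the separate treatment of trivial `A`.
  obtain ⟨l₀, hl₀⟩ : ∃ l₀ : A →L[ℝ] ℝ, l₀ 1 = 1 :=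
    SeparatingDual.exists_eq_one one_ne_zero
  -- Because `U` contains the boundary, this compact set lies in `D`, and its complement in `D ∪ U`
  -- is exactly the connected set `U`.
  set K : Set (Fin n → A) := closure D \ U with hK
  have hKD : K ⊆ D := fun x hx => by
    by_contra hxD
    exact hx.2 (hDU ⟨hx.1, fun hi => hxD (interior_subset hi)⟩)
  have hdiff : (D ∪ U) \ K = U := by
    ext x
    constructor
    · rintro ⟨hx, hxK⟩
      by_contra hxU
      exact hxK ⟨subset_closure (hx.resolve_right hxU), hxU⟩
    · exact fun hx => ⟨Or.inr hx, fun hxK => hxK.2 hx⟩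
  obtain ⟨hf1, hf2⟩ := isCauchyOn_powBasis_iff.1 hf
  have d : σ.ExtData e a φ f K (D ∪ U) :=
    { isOpen := hD.isOpen.union hU
      isCompact := (hD.isBounded.isCompact_closure).diff hU
      subset := hKD.trans subset_union_left
      kernel := hφ
      contDiffOn := by rwa [hdiff]
      slice := fun x hx m => hf2 x (hdiff ▸ hx) i₀ m }
  obtain ⟨F, hF, hFf⟩ := d.exists_extension (hestv.powBasis n) hestv (by rwa [hdiff])
    (by rw [hdiff]; exact hUconn.isPreconnected) (w := Pi.single i₁ 1)
    (l := l₀.comp (ContinuousLinearMap.proj i₁)) (by simp [σ, hne]) (by simp [σ, hne.symm])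
    (by simpa using hl₀)
  exact ⟨F, hF, by rwa [hdiff] at hFf⟩
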